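/- Let $d,r\ge 1$ be integers. Let $H^2=H^2(\mathbb C^d)$ be the symmetric Fock space over $\mathbb C^d$, realized as the Hilbert space of power series $f=\sum_{n\in\mathbb Z_{\ge0}^d}a_nz^n$ with $\|f\|^2=\sum_n\frac{n!}{|n|!}|a_n|^2<\infty$ (where $n!=n_1!\cdots n_d!$, $|n|=n_1+\dots+n_d$), and let $\bar S=(S_1,\dots,S_d)$ be the $d$-shift of rank $r$, i.e. the operators $S_k:f\otimes\zeta\mapsto z_kf\otimes\zeta$ on $H^2\otimes\mathbb C^r$. Let $X$ be any set of monomials $z^n\otimes\zeta$ ($n\in\mathbb Z_{\ge 0}^d$, $\zeta\in\mathbb C^r$), let $M\subseteq H^2\otimes\mathbb C^r$ be the smallest closed subspace that contains $X$ and is invariant under $S_1,\dots,S_d$, and let $\bar T=(T_1,\dots,T_d)$, $T_k=P_{M^\perp}S_k|_{M^\perp}$, be the compression of the $d$-shift to $M^\perp$. Let $\mathcal A$ be the unital $*$-algebra generated by $T_1,\dots,T_d$. Then: (i) the commutator ideal of $\mathcal A$, that is, the two-sided ideal of $\mathcal A$ generated by all commutators $AB-BA$ with $A,B\in\mathcal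 A$, is contained in the Schatten--von Neumann class $\mathcal L^p$ for every $p>d$; (ii) $\bar T$ is a Fredholm multioperator: $T_1,\dots,T_d$ commute with each other, and the Dirac operator $D=B+B^*$, $B=\sum_{k=1}^dT_k\otimes C_k$, is a Fredholm operator on $M^\perp\otimes\Lambda\mathbb C^d$, where $\Lambda\mathbb C^d$ is the exterior algebra of $\mathbb C^d$ with its usual Hilbert space structure and $C_k:\omega\mapsto e_k\wedge\omega$ are the creation operators of the standard basis $e_1,\dots,e_d$. -/

import Mathlib

open scoped TensorProduct

noncomputable section

namespace DShift

/-! ## Preliminaries on Hilbert spaces -/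

/-- The inner product pulled back along an injective linear map. -/
@[reducible] def pullbackCore {V H : Type*} [AddCommGroup V] [Module ℂ V]
    [NormedAddCommGroup H] [InnerProductSpace ℂ H] (f : V →ₗ[ℂ] H)
    (hf : Function.Injective f) : InnerProductSpace.Core ℂ V where
  inner x y := inner ℂ (f x) (f y)
  conj_inner_symm x y := inner_conj_symm _ _
  re_inner_nonneg x := inner_self_nonneg
  add_left x y z := by rw [map_add, inner_add_left]
  smul_left x y c := by rw [map_smul, inner_smul_left]
  definite x hx := hf (by rw [map_zero]; exact inner_self_eq_zero.1 hx)

/-- For an orthonormal basis `b` of `F`, the map `(x_i) ↦ ∑ x_i ⊗ b_i` is isometric. -/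
def tensorIsometry {H F : Type*} [NormedAddCommGroup H] [InnerProductSpace ℂ H]
    [NormedAddCommGroup F] [InnerProductSpace ℂ F] {ι : Type*} [Fintype ι]
    (b : OrthonormalBasis ι ℂ F) : PiLp 2 (fun _ : ι => H) →ₗᵢ[ℂ] H ⊗[ℂ] F where
  toFun x := ∑ i, x i ⊗ₜ[ℂ] b i
  map_add' x y := by simp [TensorProduct.add_tmul, Finset.sum_add_distrib]
  map_smul' c x := by simp [TensorProduct.smul_tmul', Finset.smul_sum]
  norm_map' x := by
    classical
    have h : inner ℂ (∑ i, x i ⊗ₜ[ℂ] b i) (∑ i, x i ⊗ₜ[ℂ] b i) = inner ℂ x x := by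
      simp only [sum_inner, inner_sum, PiLp.inner_apply, OrthonormalBasis.inner_eq_ite,
        TensorProduct.inner_tmul]
      simp
    have h' : ‖∑ i, x i ⊗ₜ[ℂ] b i‖ ^ 2 = ‖x‖ ^ 2 := by
      rw [InnerProductSpace.norm_sq_eq_re_inner (𝕜 := ℂ) (∑ i, x i ⊗ₜ[ℂ] b i),
        InnerProductSpace.norm_sq_eq_re_inner (𝕜 := ℂ) x, h]
    exact (sq_eq_sq₀ (norm_nonneg _) (norm_nonneg _)).1 h'

/-- If `F` is finite dimensional then the algebraic tensor product `H ⊗ F` of Hilbert spaces is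
already complete, so it is the Hilbert space tensor product. -/
instance instCompleteSpaceTensor {H F : Type*} [NormedAddCommGroup H] [InnerProductSpace ℂ H]
    [NormedAddCommGroup F] [InnerProductSpace ℂ F] [CompleteSpace H] [FiniteDimensional ℂ F] :
    CompleteSpace (H ⊗[ℂ] F) := by
  let b := stdOrthonormalBasis ℂ F
  have hs : Function.Surjective (tensorIsometry (H := H) b) := by
    have h : LinearMap.range (tensorIsometry (H := H) b).toLinearMap = ⊤ := by
      rw [eq_top_iff, ← TensorProduct.span_tmul_eq_top, Submodule.span_le]
      rintro _ ⟨x, y, rfl⟩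
      refine ⟨WithLp.toLp 2 (fun i => (b.repr y i) • x), ?_⟩
      conv_rhs => rw [← b.sum_repr y]
      simp [tensorIsometry, TensorProduct.tmul_sum, TensorProduct.smul_tmul]
    exact LinearMap.range_eq_top.1 h
  exact (LinearIsometryEquiv.ofSurjective (tensorIsometry (H := H) b)
    hs).symm.toIsometryEquiv.completeSpace

/-! ## The space `H²(ℂ^d)` -/

/-- The squared norm `n! / |n|!` of the monomial `z^n` in `H²(ℂ^d)`. -/
def weight {d : ℕ} (n : Fin d →₀ ℕ) : ℝ :=
  (∏ k, (Nat.factorial (n k) : ℝ)) / (Nat.factorial (∑ k, n k) : ℝ)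

lemma weight_pos {d : ℕ} (n : Fin d →₀ ℕ) : 0 < weight n :=
  div_pos (Finset.prod_pos fun k _ => by exact_mod_cast Nat.factorial_pos _)
    (by exact_mod_cast Nat.factorial_pos _)

/-- The weighted coefficient family `(√(weight n) · f_n)_n` of a power series `f`. -/
def weightedCoeff {d : ℕ} (f : MvPowerSeries (Fin d) ℂ) (n : Fin d →₀ ℕ) : ℂ :=
  (Real.sqrt (weight n) : ℂ) * MvPowerSeries.coeff n f

lemma norm_weightedCoeff_sq {d : ℕ} (f : MvPowerSeries (Fin d) ℂ) (n : Fin d →₀ ℕ) :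
    ‖weightedCoeff f n‖ ^ 2 = weight n * ‖MvPowerSeries.coeff n f‖ ^ 2 := by
  rw [weightedCoeff, norm_mul, mul_pow, Complex.norm_real, Real.norm_eq_abs, sq_abs,
    Real.sq_sqrt (weight_pos n).le]

lemma memℓp_weightedCoeff {d : ℕ} {f : MvPowerSeries (Fin d) ℂ} :
    Memℓp (weightedCoeff f) 2 ↔
      Summable fun n => weight n * ‖MvPowerSeries.coeff n f‖ ^ 2 := by
  rw [memℓp_gen_iff (by norm_num)]
  simp [norm_weightedCoeff_sq]

/-- The power series `∑ a_n z^n` with `∑ (n! / |n|!) |a_n|² < ∞`. -/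
def H2Submodule (d : ℕ) : Submodule ℂ (MvPowerSeries (Fin d) ℂ) where
  carrier := {f | Summable fun n => weight n * ‖MvPowerSeries.coeff n f‖ ^ 2}
  zero_mem' := by simp
  add_mem' {f g} hf hg := by
    rw [Set.mem_ofPred_eq, ← memℓp_weightedCoeff] at hf hg ⊢
    have h : weightedCoeff (f + g) = weightedCoeff f + weightedCoeff g := by
      funext n; simp [weightedCoeff, mul_add]
    rw [h]; exact hf.add hg
  smul_mem' c f hf := by
    rw [Set.mem_ofPred_eq, ← memℓp_weightedCoeff] at hf ⊢
    have h : weightedCoeff (c • f) = c • weightedCoeff f := by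
      funext n; simp [weightedCoeff]; ring
    rw [h]; exact hf.const_smul c

/-- The symmetric Fock space `H² = H²(ℂ^d)` in its function-theoretic realization: the power
series `f = ∑ a_n z^n` in `d` variables with `‖f‖² = ∑ (n! / |n|!) |a_n|² < ∞`. (Here `z^n` is
the symmetric tensor product of `n_1` copies of `e_1`, ..., `n_d` copies of `e_d`, whose squared
norm in the `|n|`-fold tensor power of `ℂ^d` is `n! / |n|!`.) -/
def H2 (d : ℕ) : Type := H2Submodule d

instance (d : ℕ) : AddCommGroup (H2 d) := inferInstanceAs (AddCommGroup (H2Submodule d))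

instance (d : ℕ) : Module ℂ (H2 d) := inferInstanceAs (Module ℂ (H2Submodule d))

/-- The map `f ↦ (√(weight n) · f_n)_n` from `H²` to `ℓ²`. -/
def toEll2 (d : ℕ) : H2 d →ₗ[ℂ] lp (fun _ : Fin d →₀ ℕ => ℂ) 2 where
  toFun f := ⟨weightedCoeff f.1, memℓp_weightedCoeff.2 f.2⟩
  map_add' f g := by
    ext n
    exact (congrArg ((Real.sqrt (weight n) : ℂ) * ·)
      (map_add (MvPowerSeries.coeff n) f.1 g.1)).trans (mul_add _ _ _)
  map_smul' c f := by
    ext n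
    exact (congrArg ((Real.sqrt (weight n) : ℂ) * ·)
      (map_smul (MvPowerSeries.coeff n) c f.1)).trans (mul_left_comm _ _ _)

lemma toEll2_bijective (d : ℕ) : Function.Bijective (toEll2 d) := by
  have hw : ∀ n : Fin d →₀ ℕ, (Real.sqrt (weight n) : ℂ) ≠ 0 := fun n => by
    exact_mod_cast (Real.sqrt_pos.2 (weight_pos n)).ne'
  constructor
  · intro f g h
    apply Subtype.ext
    ext n
    have := congrFun (congrArg Subtype.val h) n
    exact mul_left_cancel₀ (hw n) this
  · intro a
    let f : MvPowerSeries (Fin d) ℂ := fun n => (Real.sqrt (weight n) : ℂ)⁻¹ * a n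
    have hf : weightedCoeff f = a := by
      funext n
      exact mul_inv_cancel_left₀ (hw n) (a n)
    refine ⟨⟨f, memℓp_weightedCoeff.1 (hf ▸ a.2)⟩, ?_⟩
    exact Subtype.ext hf

instance (d : ℕ) : NormedAddCommGroup (H2 d) :=
  (pullbackCore (toEll2 d) (toEll2_bijective d).1).toNormedAddCommGroup

instance (d : ℕ) : InnerProductSpace ℂ (H2 d) :=
  InnerProductSpace.ofCore (pullbackCore (toEll2 d) (toEll2_bijective d).1).toCore

/-- `H²` is isometrically isomorphic to `ℓ²` through its weighted coefficients. -/
def ell2Equiv (d : ℕ) : H2 d ≃ₗᵢ[ℂ] lp (fun _ : Fin d →₀ ℕ => ℂ) 2 :=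
  LinearIsometryEquiv.ofSurjective
    ⟨toEll2 d, fun f => by
      have h : ‖f‖ ^ 2 = ‖toEll2 d f‖ ^ 2 := by
        rw [InnerProductSpace.norm_sq_eq_re_inner (𝕜 := ℂ) f,
          InnerProductSpace.norm_sq_eq_re_inner (𝕜 := ℂ) (toEll2 d f)]
        rfl
      exact ((sq_eq_sq₀ (norm_nonneg _) (norm_nonneg _)).1 h).symm⟩ (toEll2_bijective d).2

instance (d : ℕ) : CompleteSpace (H2 d) := (ell2Equiv d).toIsometryEquiv.completeSpace

lemma H2.norm_sq_eq {d : ℕ} (f : H2 d) :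
    ‖f‖ ^ 2 = ∑' n, weight n * ‖MvPowerSeries.coeff n f.1‖ ^ 2 := by
  rw [← (ell2Equiv d).norm_map f, ← Real.rpow_natCast]
  have h := lp.norm_rpow_eq_tsum (p := 2) (by norm_num) (ell2Equiv d f)
  simp only [ENNReal.toReal_ofNat, Real.rpow_ofNat] at h
  rw [Nat.cast_ofNat, Real.rpow_ofNat, h]
  exact tsum_congr fun n => norm_weightedCoeff_sq f.1 n

/-- The monomial `z^n`, as an element of `H²`. -/
def H2.monomial {d : ℕ} (n : Fin d →₀ ℕ) : H2 d :=
  ⟨MvPowerSeries.monomial n 1, by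
    classical
    refine summable_of_hasFiniteSupport ((Set.finite_singleton n).subset fun m hm => ?_)
    by_contra hne
    exact hm (by simp [MvPowerSeries.coeff_monomial_ne hne])⟩

/-! ## The `d`-shift -/

lemma weight_add_single_le {d : ℕ} (k : Fin d) (n : Fin d →₀ ℕ) :
    weight (Finsupp.single k 1 + n) ≤ weight n := by
  classical
  have hsum : ∑ j, (Finsupp.single k 1 + n : Fin d →₀ ℕ) j = (∑ j, n j) + 1 := by
    simp [Finset.sum_add_distrib, add_comm, Finsupp.single_apply]
  have hprod : ∏ j, (Nat.factorial ((Finsupp.single k 1 + n : Fin d →₀ ℕ) j) : ℝ) =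
      (n k + 1 : ℝ) * ∏ j, (Nat.factorial (n j) : ℝ) := by
    rw [← Finset.mul_prod_erase _ _ (Finset.mem_univ k),
      ← Finset.mul_prod_erase _ (fun j => (Nat.factorial (n j) : ℝ)) (Finset.mem_univ k),
      ← mul_assoc]
    congr 1
    · simp [add_comm 1 (n k), Nat.factorial_succ]
    · refine Finset.prod_congr rfl fun j hj => ?_
      simp [(Finset.ne_of_mem_erase hj).symm]
  have hk : (n k : ℝ) ≤ ((∑ j, n j : ℕ) : ℝ) := by
    exact_mod_cast Finset.single_le_sum (f := fun j => n j) (fun _ _ => Nat.zero_le _)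
      (Finset.mem_univ k)
  rw [weight, hsum, hprod, Nat.factorial_succ, weight, Nat.cast_mul, mul_div_mul_comm]
  refine mul_le_of_le_one_left (weight_pos n).le ?_
  rw [Nat.cast_add_one]
  exact div_le_one_of_le₀ (by linarith) (by positivity)

lemma X_mul_mem {d : ℕ} (k : Fin d) (f : MvPowerSeries (Fin d) ℂ) (hf : f ∈ H2Submodule d) :
    MvPowerSeries.X k * f ∈ H2Submodule d ∧
      ∑' n, weight n * ‖MvPowerSeries.coeff n (MvPowerSeries.X k * f)‖ ^ 2 ≤
        ∑' n, weight n * ‖MvPowerSeries.coeff n f‖ ^ 2 := by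
  classical
  have hinj : Function.Injective fun n : Fin d →₀ ℕ => Finsupp.single k 1 + n :=
    add_right_injective _
  let F : (Fin d →₀ ℕ) → ℝ := fun n =>
    weight n * ‖MvPowerSeries.coeff n (MvPowerSeries.X k * f)‖ ^ 2
  have hsupp : ∀ n, n ∉ Set.range (fun n : Fin d →₀ ℕ => Finsupp.single k 1 + n) → F n = 0 := by
    intro n hn
    have hle : ¬ Finsupp.single k 1 ≤ n := fun h =>
      hn ⟨n - Finsupp.single k 1, add_tsub_cancel_of_le h⟩
    simp only [F, MvPowerSeries.X, MvPowerSeries.coeff_monomial_mul, if_neg hle]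
    simp
  have hF : ∀ n, F (Finsupp.single k 1 + n) ≤ weight n * ‖MvPowerSeries.coeff n f‖ ^ 2 := by
    intro n
    have h : MvPowerSeries.coeff (Finsupp.single k 1 + n) (MvPowerSeries.X k * f) =
        MvPowerSeries.coeff n f := by
      rw [MvPowerSeries.X, MvPowerSeries.coeff_add_monomial_mul, one_mul]
    simp only [F, h]
    exact mul_le_mul_of_nonneg_right (weight_add_single_le k n) (sq_nonneg _)
  have hF0 : ∀ n, 0 ≤ F n := fun n => mul_nonneg (weight_pos n).le (sq_nonneg _)
  have hs : Summable (F ∘ fun n : Fin d →₀ ℕ => Finsupp.single k 1 + n) :=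
    Summable.of_nonneg_of_le (fun n => hF0 _) hF hf
  refine ⟨(hinj.summable_iff fun n hn => hsupp n hn).1 hs, ?_⟩
  have ht : ∑' n, F n = ∑' n, F (Finsupp.single k 1 + n) :=
    (hinj.tsum_eq fun n hn => by
      by_contra h
      exact hn (hsupp n h)).symm
  exact ht.trans_le (hs.tsum_le_tsum hF hf)

/-- The `d`-shift of rank one: multiplication `f ↦ z_k f` by the `k`th coordinate on `H²`. -/
def shift {d : ℕ} (k : Fin d) : H2 d →L[ℂ] H2 d :=
  LinearMap.mkContinuous
    { toFun := fun f => (⟨MvPowerSeries.X k * f.1, (X_mul_mem k f.1 f.2).1⟩ : H2Submodule d)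
      map_add' := fun f g => Subtype.ext (mul_add (MvPowerSeries.X k) f.1 g.1)
      map_smul' := fun c f => Subtype.ext (mul_smul_comm c (MvPowerSeries.X k) f.1) }
    1 fun f => by
      rw [one_mul]
      refine (sq_le_sq₀ (norm_nonneg _) (norm_nonneg _)).1 ?_
      rw [H2.norm_sq_eq, H2.norm_sq_eq]
      exact (X_mul_mem k f.1 f.2).2

/-- The Hilbert space `H² ⊗ ℂ^r` on which the `d`-shift of rank `r` acts. -/
def H2Vec (d r : ℕ) : Type := H2 d ⊗[ℂ] EuclideanSpace ℂ (Fin r)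

instance (d r : ℕ) : NormedAddCommGroup (H2Vec d r) :=
  inferInstanceAs (NormedAddCommGroup (H2 d ⊗[ℂ] EuclideanSpace ℂ (Fin r)))

instance (d r : ℕ) : InnerProductSpace ℂ (H2Vec d r) :=
  inferInstanceAs (InnerProductSpace ℂ (H2 d ⊗[ℂ] EuclideanSpace ℂ (Fin r)))

instance (d r : ℕ) : CompleteSpace (H2Vec d r) :=
  inferInstanceAs (CompleteSpace (H2 d ⊗[ℂ] EuclideanSpace ℂ (Fin r)))

/-- The elementary tensor `f ⊗ ζ` in `H² ⊗ ℂ^r`. -/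
def H2Vec.tmul {d r : ℕ} (f : H2 d) (ζ : EuclideanSpace ℂ (Fin r)) : H2Vec d r := f ⊗ₜ[ℂ] ζ

/-- The `d`-shift of rank `r`: the operators `S_k : f ⊗ ζ ↦ z_k f ⊗ ζ` on `H² ⊗ ℂ^r`. -/
def vecShift (d r : ℕ) (k : Fin d) : H2Vec d r →L[ℂ] H2Vec d r :=
  (TensorProduct.mapL (shift k) (ContinuousLinearMap.id ℂ (EuclideanSpace ℂ (Fin r))) :
    H2 d ⊗[ℂ] EuclideanSpace ℂ (Fin r) →L[ℂ] H2 d ⊗[ℂ] EuclideanSpace ℂ (Fin r))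

/-- The monomials `z^n ⊗ ζ` in `H² ⊗ ℂ^r`. -/
def monomials (d r : ℕ) : Set (H2Vec d r) :=
  {ξ | ∃ (n : Fin d →₀ ℕ) (ζ : EuclideanSpace ℂ (Fin r)), ξ = H2Vec.tmul (H2.monomial n) ζ}

/-! ## Multioperators, Dirac operators -/

section Multioperator

variable {d : ℕ} {H : Type*} [NormedAddCommGroup H] [InnerProductSpace ℂ H]

/-- The smallest closed subspace that contains `X` and is invariant under all `A_k`. -/
def closedInvariantSpan (A : Fin d → H →L[ℂ] H) (X : Set H) : Submodule ℂ H :=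
  sInf {N | IsClosed (N : Set H) ∧ X ⊆ N ∧ ∀ k, ∀ x ∈ N, A k x ∈ N}

/-- The compression `P_K A |_K` of an operator to a subspace `K`. -/
def compression (K : Submodule ℂ H) [K.HasOrthogonalProjection] (A : H →L[ℂ] H) : K →L[ℂ] K :=
  K.orthogonalProjectionOnto ∘L A ∘L K.subtypeL

/-- The exterior algebra `Λ ℂ^d`. -/
def Exterior (d : ℕ) : Type := ExteriorAlgebra ℂ (EuclideanSpace ℂ (Fin d))

instance (d : ℕ) : Ring (Exterior d) :=
  inferInstanceAs (Ring (ExteriorAlgebra ℂ (EuclideanSpace ℂ (Fin d))))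

instance (d : ℕ) : Algebra ℂ (Exterior d) :=
  inferInstanceAs (Algebra ℂ (ExteriorAlgebra ℂ (EuclideanSpace ℂ (Fin d))))

/-- The basis `e_I = e_{i_1} ∧ ⋯ ∧ e_{i_k}` of `Λ ℂ^d`, for `I = {i_1 < ⋯ < i_k}`, where
`e_1, …, e_d` is the standard basis of `ℂ^d`. -/
def exteriorBasis (d : ℕ) : Module.Basis (Finset (Fin d)) ℂ (Exterior d) :=
  (EuclideanSpace.basisFun (Fin d) ℂ).toBasis.ExteriorAlgebra

/-- The coordinates of an element of `Λ ℂ^d` in the basis `e_I`. -/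
def exteriorCoord (d : ℕ) : Exterior d ≃ₗ[ℂ] EuclideanSpace ℂ (Finset (Fin d)) :=
  (exteriorBasis d).equivFun.trans (WithLp.linearEquiv 2 ℂ (Finset (Fin d) → ℂ)).symm

/-- The Hilbert space structure of `Λ ℂ^d`, in which the `e_I` are orthonormal; this is the inner
product with `⟪z_1 ∧ ⋯ ∧ z_k, w_1 ∧ ⋯ ∧ w_k⟫ = det ⟪z_i, w_j⟫` and `Λ^k ⟂ Λ^l` for `k ≠ l`. -/
instance (d : ℕ) : NormedAddCommGroup (Exterior d) :=
  (pullbackCore (exteriorCoord d).toLinearMap (exteriorCoord d).injective).toNormedAddCommGroup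

instance (d : ℕ) : InnerProductSpace ℂ (Exterior d) :=
  InnerProductSpace.ofCore
    (pullbackCore (exteriorCoord d).toLinearMap (exteriorCoord d).injective).toCore

instance (d : ℕ) : FiniteDimensional ℂ (Exterior d) :=
  (exteriorBasis d).finiteDimensional_of_finite

/-- The standard basis vector `e_k` of `ℂ^d`, as an element of `Λ ℂ^d`. -/
def exteriorGen (k : Fin d) : Exterior d :=
  ExteriorAlgebra.ι ℂ (EuclideanSpace.single k (1 : ℂ))

/-- The creation operator `C_k : ω ↦ e_k ∧ ω` on `Λ ℂ^d`. -/
def creation (k : Fin d) : Exterior d →L[ℂ] Exterior d :=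
  LinearMap.toContinuousLinearMap (LinearMap.mulLeft ℂ (exteriorGen k))

/-- The Dirac operator `D = B + B*` of `T`, acting on `H ⊗ Λ ℂ^d`, where `B = ∑_k T_k ⊗ C_k`. -/
def dirac [CompleteSpace H] (T : Fin d → H →L[ℂ] H) :
    H ⊗[ℂ] Exterior d →L[ℂ] H ⊗[ℂ] Exterior d :=
  (∑ k, TensorProduct.mapL (T k) (creation k)) +
    ContinuousLinearMap.adjoint (∑ k, TensorProduct.mapL (T k) (creation k))

/-- `T` is a Fredholm multioperator: the operators `T_k` commute with each other and the Dirac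
operator of `T` is a Fredholm operator. -/
def IsFredholmMultioperator [CompleteSpace H] (T : Fin d → H →L[ℂ] H) : Prop :=
  (∀ j k, Commute (T j) (T k)) ∧ (dirac T).IsFredholm

end Multioperator

/-! ## Schatten classes, commutator ideals -/

/-- The singular numbers `s_0(A) ≥ s_1(A) ≥ ⋯` of an operator on a Hilbert space, where `s_n(A)`
is the distance from `A` to the operators of rank at most `n`. -/
def singularNumber {H : Type*} [NormedAddCommGroup H] [InnerProductSpace ℂ H]
    (A : H →L[ℂ] H) (n : ℕ) : ℝ :=
  sInf {t | ∃ F : H →L[ℂ] H, F.toLinearMap.rank ≤ n ∧ t = ‖A - F‖}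

/-- `A` belongs to the Schatten-von Neumann class `𝓛^p`, `0 < p < ∞`. -/
def InSchatten {H : Type*} [NormedAddCommGroup H] [InnerProductSpace ℂ H]
    (p : ℝ) (A : H →L[ℂ] H) : Prop :=
  Summable fun n => singularNumber A n ^ p

/-- The commutator ideal of a ring: the two-sided ideal generated by all `ab - ba`. -/
def commutatorIdeal (R : Type*) [Ring R] : TwoSidedIdeal R :=
  TwoSidedIdeal.span {x | ∃ a b : R, x = a * b - b * a}

end DShift

end

/-!
The submodule `M` generated by monomials is the orthogonal sum of spaces `z^n ⊗ V_n`, where the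
subspaces `V_n` of `ℂ^r` increase with `n ∈ ℕ^d`. On `M^⊥` the compression `T_k` is a weighted shift
composed with projections: up to normalization of the monomials it maps `z^n ⊗ ζ` to
`√((n_k + 1) / (|n| + 1)) z^n z_k ⊗ P ζ`, with `P` the projection onto the complement of
`V_{n + e_k}`, while `T_k*` is the restriction of `S_k*`. So `[T_j, T_k*]` maps the component of
index `n` to the one of index `m = n + e_j - e_k`.

The main point is that its norm there is `O(1 / |n|)`. The weights of `T_j T_k*` and `T_k* T_j`
differ by `O(1 / |n|)` (`abs_shiftWeight_mul_sub_le`), and the projections agree unless `V` jumps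
both from `n` to `n + e_j` and from `m` to `m + e_k` (`fiberProjection_eq_or`). By Dickson's lemma
(`exists_bound_of_monotone`) a jump in the direction `k` happens only at bounded values of the `k`th
exponent, so at such an index the exponents of both `z_j` and `z_k` are bounded and the weights
themselves, of size `√(n_j n_k) / |n|`, are `O(1 / |n|)`. Here it matters that both exponents are
bounded: a single one would only give `O(|n|^{-1/2})`.

Cutting off the `O(N^d)` components of degree less than `N` approximates the commutator up to
`O(1 / N)` by an operator of rank `O(N^d)`. Operators with this property form an ideal
(`InWeakSchatten`, the weak class `𝓛^{d,∞}`) which is contained in `𝓛^p` for every `p > d`. As the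
generators of the *-algebra commute modulo this ideal, it contains the commutator ideal.

For the Fredholm property, the anticommutation relations of the creation operators give
`D² = ∑ T_k T_k* ⊗ 1 + ∑ [T_j*, T_k] ⊗ C_j* C_k` (`dirac_mul_dirac`). The second sum is a norm limit
of operators of finite rank by the above, and `1 - ∑ T_k T_k*` has finite rank because the weights
satisfy `∑ n_k / |n| = 1` for `n ≠ 0`. Hence `D²`, and with it `D`, is invertible modulo operators of
finite rank (`isFredholm_of_sq`).
-/

noncomputable section

namespace DShift

/-! ### Weak Schatten classes and commutator ideals -/

section Approximation

variable {H : Type*} [NormedAddCommGroup H] [InnerProductSpace ℂ H]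

lemma singularNumber_nonneg (A : H →L[ℂ] H) (n : ℕ) : 0 ≤ singularNumber A n := by
  refine Real.sInf_nonneg ?_
  rintro _ ⟨F, -, rfl⟩
  exact norm_nonneg _

lemma singularNumber_le {A F : H →L[ℂ] H} {n : ℕ} (hF : F.toLinearMap.rank ≤ n) :
    singularNumber A n ≤ ‖A - F‖ :=
  csInf_le ⟨0, by rintro _ ⟨F, -, rfl⟩; exact norm_nonneg _⟩ ⟨F, hF, rfl⟩

/-- Operators whose approximation numbers decay at the rate `n ^ (-1 / d)`, that is, the weak
Schatten class `𝓛^{d,∞}`: `A` is within `O(1 / N)` of an operator of rank `O(N ^ d)`. -/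
def InWeakSchatten (d : ℕ) (A : H →L[ℂ] H) : Prop :=
  ∃ (c : ℝ) (m : ℕ), ∀ N : ℕ, ∃ F : H →L[ℂ] H,
    F.toLinearMap.rank ≤ (m * N ^ d : ℕ) ∧ ‖A - F‖ ≤ c / (N + 1)

/-- A norm limit of operators of finite rank. -/
def IsFiniteRankLimit (A : H →L[ℂ] H) : Prop :=
  ∀ ε > 0, ∃ F : H →L[ℂ] H, F.toLinearMap.HasFiniteRange ∧ ‖A - F‖ < ε

namespace InWeakSchatten

variable {d : ℕ} {A B : H →L[ℂ] H}

lemma zero : InWeakSchatten d (0 : H →L[ℂ] H) :=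
  ⟨0, 0, fun N => ⟨0, by simp, by simp⟩⟩

lemma add (hA : InWeakSchatten d A) (hB : InWeakSchatten d B) : InWeakSchatten d (A + B) := by
  obtain ⟨a, m, hA⟩ := hA
  obtain ⟨b, n, hB⟩ := hB
  refine ⟨a + b, m + n, fun N => ?_⟩
  obtain ⟨F, hF, hAF⟩ := hA N
  obtain ⟨G, hG, hBG⟩ := hB N
  refine ⟨F + G, ?_, ?_⟩
  · refine (LinearMap.rank_add_le F.toLinearMap G.toLinearMap).trans ((add_le_add hF hG).trans ?_)
    rw [add_mul]
    exact_mod_cast le_rfl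
  · rw [add_sub_add_comm, add_div]
    exact (norm_add_le _ _).trans (add_le_add hAF hBG)

lemma mul_left (B : H →L[ℂ] H) (hA : InWeakSchatten d A) : InWeakSchatten d (B * A) := by
  obtain ⟨a, m, hA⟩ := hA
  refine ⟨‖B‖ * a, m, fun N => ?_⟩
  obtain ⟨F, hF, hAF⟩ := hA N
  refine ⟨B * F, (LinearMap.rank_comp_le_right F.toLinearMap B.toLinearMap).trans hF, ?_⟩
  rw [← mul_sub, mul_div_assoc]
  exact (norm_mul_le _ _).trans (mul_le_mul_of_nonneg_left hAF (norm_nonneg _))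

lemma mul_right (B : H →L[ℂ] H) (hA : InWeakSchatten d A) : InWeakSchatten d (A * B) := by
  obtain ⟨a, m, hA⟩ := hA
  refine ⟨a * ‖B‖, m, fun N => ?_⟩
  obtain ⟨F, hF, hAF⟩ := hA N
  refine ⟨F * B, (LinearMap.rank_comp_le_left B.toLinearMap F.toLinearMap).trans hF, ?_⟩
  rw [← sub_mul, mul_div_right_comm]
  exact (norm_mul_le _ _).trans (mul_le_mul_of_nonneg_right hAF (norm_nonneg _))

lemma neg (hA : InWeakSchatten d A) : InWeakSchatten d (-A) := by
  simpa using hA.mul_left (-1)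

lemma isFiniteRankLimit (hA : InWeakSchatten d A) : IsFiniteRankLimit A := by
  intro ε hε
  obtain ⟨c, m, hA⟩ := hA
  have hlim : Filter.Tendsto (fun N : ℕ => c / ((N : ℝ) + 1)) Filter.atTop (nhds 0) := by
    simpa [div_eq_mul_inv] using tendsto_one_div_add_atTop_nhds_zero_nat.const_mul c
  obtain ⟨N, hN⟩ := (hlim.eventually (gt_mem_nhds hε)).exists
  obtain ⟨F, hF, hAF⟩ := hA N
  refine ⟨F, ?_, hAF.trans_lt hN⟩
  have : Module.rank ℂ (LinearMap.range F.toLinearMap) < Cardinal.aleph0 :=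
    hF.trans_lt (Cardinal.natCast_lt_aleph0)
  rw [LinearMap.hasFiniteRange_iff_range, ← Module.Finite.iff_fg]
  exact Module.rank_lt_aleph0_iff.1 this

/-- The weak Schatten class `𝓛^{d,∞}` is contained in `𝓛^p` for `p > d`: if
`m N ^ d ≤ n < m (N + 1) ^ d` then `s_n(A) ≤ c / (N + 1) ≤ c (m / n) ^ (1 / d)`, and
`∑ n ^ (-p / d)` converges. -/
lemma inSchatten (hd : 0 < d) (hA : InWeakSchatten d A) {p : ℝ} (hp : (d : ℝ) < p) :
    InSchatten p A := by
  obtain ⟨c, m, hA⟩ := hA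
  have hd' : (0 : ℝ) < d := by exact_mod_cast hd
  have hp0 : 0 < p := hd'.trans hp
  have hc : 0 ≤ c := by
    obtain ⟨F, -, hF⟩ := hA 0
    simpa using (norm_nonneg _).trans hF
  have hle : ∀ n : ℕ, singularNumber A n ≤
      c * (((m + 1 : ℕ) : ℝ) / ((n : ℝ) + 1)) ^ (1 / (d : ℝ)) := by
    intro n
    -- The factor `m + 1` in place of `m` makes such a largest `N` exist also for `m = 0`.
    let N := Nat.findGreatest (fun N => (m + 1) * N ^ d ≤ n) n
    have hN1 : (m + 1) * N ^ d ≤ n :=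
      Nat.findGreatest_spec (P := fun N => (m + 1) * N ^ d ≤ n) (Nat.zero_le n)
        (by simp [zero_pow hd.ne'])
    have hN2 : n < (m + 1) * (N + 1) ^ d := by
      by_contra! h
      have hle : N + 1 ≤ n :=
        (Nat.le_self_pow hd.ne' _).trans ((Nat.le_mul_of_pos_left _ (Nat.succ_pos m)).trans h)
      exact absurd (Nat.le_findGreatest (P := fun N => (m + 1) * N ^ d ≤ n) hle h)
        (Nat.not_succ_le_self N)
    obtain ⟨F, hF, hAF⟩ := hA N
    have hrank : m * N ^ d ≤ n := (Nat.mul_le_mul_right _ (Nat.le_succ m)).trans hN1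
    refine (singularNumber_le (hF.trans (by exact_mod_cast hrank))).trans (hAF.trans ?_)
    rw [div_eq_mul_inv]
    refine mul_le_mul_of_nonneg_left ?_ hc
    rw [one_div, Real.le_rpow_inv_iff_of_pos (by positivity) (by positivity) hd',
      Real.rpow_natCast, inv_pow, ← one_div, div_le_div_iff₀ (by positivity) (by positivity),
      one_mul]
    exact_mod_cast hN2
  refine Summable.of_nonneg_of_le (fun n => Real.rpow_nonneg (singularNumber_nonneg A n) p)
    (fun n => Real.rpow_le_rpow (singularNumber_nonneg A n) (hle n) hp0.le) ?_
  have hs : Summable fun n : ℕ => (((n : ℝ) + 1) ^ (p / d))⁻¹ := by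
    have := (summable_nat_add_iff 1).2 (Real.summable_nat_rpow_inv.2 ((one_lt_div hd').2 hp))
    simpa using this
  refine (hs.mul_left (c ^ p * ((m + 1 : ℕ) : ℝ) ^ (p / d))).congr fun n => ?_
  rw [Real.mul_rpow hc (by positivity), ← Real.rpow_mul (by positivity),
    Real.div_rpow (by positivity) (by positivity), one_div_mul_eq_div]
  ring

end InWeakSchatten

variable [CompleteSpace H]

/-- If `T_1, …, T_d` commute modulo the weak Schatten class with each other and with each other's
adjoints, then the commutator ideal of the *-algebra they generate is contained in that class. -/
lemma inWeakSchatten_of_mem_commutatorIdeal {d : ℕ} {ι : Type*} (T : ι → H →L[ℂ] H)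
    (hT : ∀ j k, Commute (T j) (T k))
    (hT' : ∀ j k, InWeakSchatten d (T j * star (T k) - star (T k) * T j))
    (x : StarAlgebra.adjoin ℂ (Set.range T))
    (hx : x ∈ commutatorIdeal (StarAlgebra.adjoin ℂ (Set.range T))) :
    InWeakSchatten d (x : H →L[ℂ] H) := by
  let s : Set (H →L[ℂ] H) := Set.range T ∪ star (Set.range T)
  have hgen : ∀ a ∈ s, ∀ b ∈ s, InWeakSchatten d (a * b - b * a) := by
    have hswap : ∀ {a b : H →L[ℂ] H}, InWeakSchatten d (a * b - b * a) →
        InWeakSchatten d (b * a - a * b) := fun h => by simpa using h.neg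
    have hs : ∀ a ∈ s, ∃ j, a = T j ∨ a = star (T j) := by
      rintro a (⟨j, rfl⟩ | ⟨j, hj⟩)
      · exact ⟨j, .inl rfl⟩
      · exact ⟨j, .inr (by rw [hj, star_star])⟩
    have hzero : ∀ {a b : H →L[ℂ] H}, Commute a b → InWeakSchatten d (a * b - b * a) :=
      fun h => by rw [h.eq, sub_self]; exact .zero
    intro a ha b hb
    obtain ⟨j, rfl | rfl⟩ := hs a ha <;> obtain ⟨k, rfl | rfl⟩ := hs b hb
    · exact hzero (hT j k)
    · exact hT' j k
    · exact hswap (hT' k j)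
    · exact hzero (hT j k).star_star
  have hind : ∀ a : H →L[ℂ] H, (∀ b ∈ s, InWeakSchatten d (a * b - b * a)) →
      ∀ b ∈ Algebra.adjoin ℂ s, InWeakSchatten d (a * b - b * a) := by
    intro a ha b hb
    induction hb using Algebra.adjoin_induction with
    | mem b hb => exact ha b hb
    | algebraMap c => rw [Algebra.commutes, sub_self]; exact .zero
    | add b b' _ _ h h' =>
      convert h.add h' using 1
      noncomm_ring
    | mul b b' _ _ h h' =>
      convert (h.mul_right b').add (h'.mul_left b) using 1
      noncomm_ring
  have hcomm : ∀ a ∈ Algebra.adjoin ℂ s, ∀ b ∈ Algebra.adjoin ℂ s,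
      InWeakSchatten d (a * b - b * a) := fun a ha => hind a fun b hb => by
    simpa using (hind b (hgen b hb) a ha).neg
  let I : TwoSidedIdeal (StarAlgebra.adjoin ℂ (Set.range T)) :=
    .mk' {y | InWeakSchatten d (y : H →L[ℂ] H)} .zero (fun h h' => h.add h') (fun h => h.neg)
      (fun h => h.mul_left _) (fun h => h.mul_right _)
  have hI : x ∈ I := TwoSidedIdeal.mem_span_iff.1 hx I fun y hy => by
    obtain ⟨a, b, rfl⟩ := hy
    rw [SetLike.mem_coe, TwoSidedIdeal.mem_mk']
    exact hcomm a a.2 b b.2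
  rwa [TwoSidedIdeal.mem_mk'] at hI

end Approximation

/-! ### Anticommutation relations on the exterior algebra -/

section Creation

variable {d : ℕ}

/-- The annihilation operator on `Λ ℂ^d`: contraction with the `k`th coordinate functional. -/
def annihilation (k : Fin d) : Exterior d →L[ℂ] Exterior d :=
  LinearMap.toContinuousLinearMap
    (CliffordAlgebra.contractLeft (Q := (0 : QuadraticForm ℂ (EuclideanSpace ℂ (Fin d))))
      (EuclideanSpace.proj k : EuclideanSpace ℂ (Fin d) →L[ℂ] ℂ).toLinearMap :
        Exterior d →ₗ[ℂ] Exterior d)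

lemma creation_apply (k : Fin d) (x : Exterior d) : creation k x = exteriorGen k * x := rfl

lemma annihilation_gen_mul (j k : Fin d) (x : Exterior d) :
    annihilation j (exteriorGen k * x) =
      (if j = k then (1 : ℂ) else 0) • x - exteriorGen k * annihilation j x := by
  refine (CliffordAlgebra.contractLeft_ι_mul (Q := (0 : QuadraticForm ℂ _)) _ _ x).trans ?_
  congr 2
  simp

lemma annihilation_one (j : Fin d) : annihilation j (1 : Exterior d) = 0 :=
  CliffordAlgebra.contractLeft_one (Q := (0 : QuadraticForm ℂ _)) _

lemma exteriorBasis_empty : exteriorBasis d ∅ = 1 := by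
  refine (ExteriorAlgebra.basis_apply_ofCard _ (Finset.card_empty)).trans ?_
  exact ExteriorAlgebra.ιMulti_zero_apply _

lemma exteriorBasis_singleton (k : Fin d) : exteriorBasis d {k} = exteriorGen k := by
  refine (ExteriorAlgebra.basis_apply_ofCard _ (Finset.card_singleton k)).trans ?_
  let s : Set.powersetCard (Fin d) 1 := Set.powersetCard.ofCard (Finset.card_singleton k)
  have hmem : Set.powersetCard.ofFinEmbEquiv.symm s 0 ∈ (s : Finset (Fin d)) :=
    (Set.powersetCard.mem_range_ofFinEmbEquiv_symm_iff_mem s _).1 ⟨0, rfl⟩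
  have h0 : Set.powersetCard.ofFinEmbEquiv.symm s 0 = k := Finset.mem_singleton.1 hmem
  change ExteriorAlgebra.ιMulti_family ℂ 1 _ s = _
  rw [ExteriorAlgebra.ιMulti_family, ExteriorAlgebra.ιMulti_apply]
  simp [h0, exteriorGen]

lemma gen_mul_exteriorBasis_of_mem {k : Fin d} {I : Finset (Fin d)} (h : k ∈ I) :
    exteriorGen k * exteriorBasis d I = 0 := by
  rw [← exteriorBasis_singleton]
  exact ExteriorAlgebra.basis_mul_of_not_disjoint (EuclideanSpace.basisFun (Fin d) ℂ).toBasis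
    ⟨{k}, Finset.card_singleton k⟩ ⟨I, rfl⟩ (by simpa using h)

lemma gen_mul_exteriorBasis_of_notMem {k : Fin d} {I : Finset (Fin d)} (h : k ∉ I) :
    ∃ s : ℝ, s * s = 1 ∧
      exteriorGen k * exteriorBasis d I = (s : ℂ) • exteriorBasis d (insert k I) := by
  rw [← exteriorBasis_singleton]
  have hd : Disjoint ({k} : Finset (Fin d)) I := by simpa using h
  have := ExteriorAlgebra.basis_mul_of_disjoint (EuclideanSpace.basisFun (Fin d) ℂ).toBasis
    (s := ⟨{k}, Finset.card_singleton k⟩) (t := ⟨I, rfl⟩) hd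
  have hU : ((Set.powersetCard.disjUnion
      (s := (⟨{k}, Finset.card_singleton k⟩ : Set.powersetCard (Fin d) 1)) (t := ⟨I, rfl⟩) hd :
        Set.powersetCard (Fin d) (1 + I.card)) : Finset (Fin d)) = insert k I :=
    Finset.disjUnion_eq_union _ _ hd
  rw [hU] at this
  rcases Int.units_eq_one_or (Set.powersetCard.permOfDisjoint
    (s := (⟨{k}, Finset.card_singleton k⟩ : Set.powersetCard (Fin d) 1)) (t := ⟨I, rfl⟩) hd).sign
    with hs | hs
  · refine ⟨1, by norm_num, ?_⟩
    rw [hs, one_smul] at this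
    rw [Complex.ofReal_one, one_smul]
    exact this
  · refine ⟨-1, by norm_num, ?_⟩
    rw [hs, Units.neg_smul, one_smul] at this
    rw [Complex.ofReal_neg, Complex.ofReal_one, neg_smul, one_smul]
    exact this

lemma annihilation_exteriorBasis_of_notMem {k : Fin d} {I : Finset (Fin d)} (h : k ∉ I) :
    annihilation k (exteriorBasis d I) = 0 := by
  induction I using Finset.induction_on with
  | empty => rw [exteriorBasis_empty, annihilation_one]
  | insert j I hj ih =>
    rw [Finset.mem_insert, not_or] at h
    obtain ⟨s, hs, hsI⟩ := gen_mul_exteriorBasis_of_notMem hj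
    have hs' : (s : ℂ) * s = 1 := by exact_mod_cast hs
    rw [← one_smul ℂ (exteriorBasis d (insert j I)), ← hs', mul_smul, ← hsI, map_smul,
      annihilation_gen_mul, ih h.2, if_neg h.1, zero_smul, mul_zero, sub_zero, smul_zero]

lemma inner_exteriorBasis (I J : Finset (Fin d)) :
    inner ℂ (exteriorBasis d I) (exteriorBasis d J) = if I = J then (1 : ℂ) else 0 := by
  change inner ℂ (exteriorCoord d (exteriorBasis d I)) (exteriorCoord d (exteriorBasis d J)) = _
  simp [exteriorCoord, PiLp.inner_apply, Finsupp.single_apply, eq_comm]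

/-- On the basis vectors both operators act by the same signs: if `k ∉ I` and
`e_k ∧ e_I = ± e_{I ∪ k}`, then contracting with `e_k` sends `e_{I ∪ k}` to `± e_I`. -/
lemma adjoint_creation (k : Fin d) :
    ContinuousLinearMap.adjoint (creation k) = annihilation k := by
  refine ((ContinuousLinearMap.eq_adjoint_iff _ _).2 fun x y => ?_).symm
  suffices h : ∀ I J, inner ℂ (annihilation k (exteriorBasis d I)) (exteriorBasis d J) =
      inner ℂ (exteriorBasis d I) (creation k (exteriorBasis d J)) by
    rw [← (exteriorBasis d).sum_repr x, ← (exteriorBasis d).sum_repr y]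
    simp only [map_sum, map_smul, sum_inner, inner_sum, inner_smul_left, inner_smul_right, h]
  intro I J
  rw [creation_apply]
  by_cases hI : k ∈ I
  · obtain ⟨I, hk, rfl⟩ : ∃ I', k ∉ I' ∧ insert k I' = I :=
      ⟨I.erase k, Finset.notMem_erase k I, Finset.insert_erase hI⟩
    obtain ⟨s, hs, hsI⟩ := gen_mul_exteriorBasis_of_notMem hk
    have hs' : (s : ℂ) * s = 1 := by exact_mod_cast hs
    have hann : annihilation k (exteriorBasis d (insert k I)) = (s : ℂ) • exteriorBasis d I := by
      rw [← one_smul ℂ (exteriorBasis d (insert k I)), ← hs', mul_smul, ← hsI, map_smul,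
        annihilation_gen_mul, annihilation_exteriorBasis_of_notMem hk, mul_zero, sub_zero,
        if_pos rfl, one_smul]
    rw [hann, inner_smul_left, inner_exteriorBasis, Complex.conj_ofReal]
    by_cases hJ : k ∈ J
    · rw [gen_mul_exteriorBasis_of_mem hJ, inner_zero_right, if_neg, mul_zero]
      rintro rfl
      exact hk hJ
    · obtain ⟨t, -, htJ⟩ := gen_mul_exteriorBasis_of_notMem hJ
      rw [htJ, inner_smul_right, inner_exteriorBasis]
      by_cases hIJ : I = J
      · subst hIJ
        have hst : (s : ℂ) • exteriorBasis d (insert k I) = (t : ℂ) • exteriorBasis d (insert k I) :=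
          hsI.symm.trans htJ
        rw [if_pos rfl, if_pos rfl,
          smul_left_injective ℂ ((exteriorBasis d).ne_zero (insert k I)) hst]
      · rw [if_neg hIJ, if_neg, mul_zero, mul_zero]
        intro h
        exact hIJ (by rw [← Finset.erase_insert hk, h, Finset.erase_insert hJ])
  · rw [annihilation_exteriorBasis_of_notMem hI, inner_zero_left]
    by_cases hJ : k ∈ J
    · rw [gen_mul_exteriorBasis_of_mem hJ, inner_zero_right]
    · obtain ⟨t, -, htJ⟩ := gen_mul_exteriorBasis_of_notMem hJ
      rw [htJ, inner_smul_right, inner_exteriorBasis, if_neg, mul_zero]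
      rintro rfl
      exact hI (Finset.mem_insert_self _ _)

lemma creation_mul_creation (j k : Fin d) :
    creation j * creation k = -(creation k * creation j) := by
  ext x
  have h : exteriorGen j * exteriorGen k + exteriorGen k * exteriorGen j = (0 : Exterior d) :=
    ExteriorAlgebra.ι_add_mul_swap _ _
  change exteriorGen j * (exteriorGen k * x) = -(exteriorGen k * (exteriorGen j * x))
  rw [← mul_assoc, ← mul_assoc, eq_neg_of_add_eq_zero_left h, neg_mul]

/-- The canonical anticommutation relations. -/
lemma adjoint_creation_mul_creation (j k : Fin d) :
    star (creation j) * creation k + creation k * star (creation j) =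
      if j = k then 1 else 0 := by
  rw [ContinuousLinearMap.star_eq_adjoint, adjoint_creation]
  ext x
  change annihilation j (exteriorGen k * x) + exteriorGen k * annihilation j x = _
  rw [annihilation_gen_mul, sub_add_cancel]
  split_ifs <;> simp

end Creation

/-! ### A Fredholm criterion and the square of the Dirac operator -/

section Fredholm

variable {H : Type*} [NormedAddCommGroup H] [InnerProductSpace ℂ H]

lemma IsFiniteRankLimit.of_hasFiniteRange {A : H →L[ℂ] H} (hA : A.toLinearMap.HasFiniteRange) :
    IsFiniteRankLimit A := fun ε hε => ⟨A, hA, by simpa using hε⟩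

lemma IsFiniteRankLimit.add {A B : H →L[ℂ] H} (hA : IsFiniteRankLimit A)
    (hB : IsFiniteRankLimit B) : IsFiniteRankLimit (A + B) := by
  intro ε hε
  obtain ⟨F, hF, hAF⟩ := hA (ε / 2) (half_pos hε)
  obtain ⟨G, hG, hBG⟩ := hB (ε / 2) (half_pos hε)
  refine ⟨F + G, hF.add hG, ?_⟩
  rw [add_sub_add_comm]
  exact (norm_add_le _ _).trans_lt (by linarith)

lemma IsFiniteRankLimit.sum {ι : Type*} (s : Finset ι) {A : ι → H →L[ℂ] H}
    (hA : ∀ i, IsFiniteRankLimit (A i)) : IsFiniteRankLimit (∑ i ∈ s, A i) := by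
  classical
  induction s using Finset.induction_on with
  | empty => exact .of_hasFiniteRange (by simp)
  | insert i s hi ih => rw [Finset.sum_insert hi]; exact (hA i).add ih

lemma IsFiniteRankLimit.mapL {V : Type*} [NormedAddCommGroup V] [InnerProductSpace ℂ V]
    [FiniteDimensional ℂ V] {A : H →L[ℂ] H} (hA : IsFiniteRankLimit A) (B : V →L[ℂ] V) :
    IsFiniteRankLimit (TensorProduct.mapL A B) := by
  intro ε hε
  obtain ⟨F, hF, hAF⟩ := hA (ε / (‖B‖ + 1)) (by positivity)
  refine ⟨TensorProduct.mapL F B, ?_, ?_⟩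
  · rw [TensorProduct.toLinearMap_mapL, LinearMap.hasFiniteRange_iff_range,
      TensorProduct.range_map]
    exact Submodule.FG.map₂ _ hF.fg_range (Module.Finite.iff_fg.1 inferInstance)
  · have : TensorProduct.mapL A B - TensorProduct.mapL F B = TensorProduct.mapL (A - F) B := by
      rw [sub_eq_iff_eq_add, ← TensorProduct.mapL_add_left, sub_add_cancel]
    rw [this]
    refine (TensorProduct.norm_mapL_le _ _).trans_lt ?_
    calc ‖A - F‖ * ‖B‖ ≤ ‖A - F‖ * (‖B‖ + 1) := by gcongr; linarith
      _ < ε := (lt_div_iff₀ (by positivity)).1 hAF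

/-- If `D²` is the identity up to a norm limit of operators of finite rank, then `D` is Fredholm:
`D² = G + F` with `G` invertible and `F` of finite rank, so `D G⁻¹` and `G⁻¹ D` are a right and
a left inverse of `D` up to operators of finite rank. -/
lemma isFredholm_of_sq [CompleteSpace H] {D : H →L[ℂ] H} (hD : IsFiniteRankLimit (D * D - 1)) :
    D.IsFredholm := by
  obtain ⟨F, hF, hn⟩ := hD 1 one_pos
  have hu : IsUnit (D * D - F) := by
    have := (Units.oneSub (-(D * D - 1 - F)) (by rwa [norm_neg])).isUnit
    rw [Units.val_oneSub] at this
    convert this using 1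
    abel
  obtain ⟨G, hG⟩ := hu
  have hsq : D * D = G + F := by rw [hG, sub_add_cancel]
  have hfin : ∀ {A B : H →L[ℂ] H}, (A - B).toLinearMap.HasFiniteRange →
      LinearMap.FiniteRangeSetoid.setoid A.toLinearMap B.toLinearMap := fun h =>
    LinearMap.FiniteRangeSetoid.equiv_iff_hasFiniteRange.2 h
  have hright : (D * (D * (G⁻¹ : (H →L[ℂ] H)ˣ)) - 1 : H →L[ℂ] H).toLinearMap.HasFiniteRange := by
    have : D * (D * (G⁻¹ : (H →L[ℂ] H)ˣ)) - 1 = F * (G⁻¹ : (H →L[ℂ] H)ˣ) := by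
      rw [← mul_assoc, hsq, add_mul, Units.mul_inv, add_sub_cancel_left]
    rw [this]
    exact hF.comp_right _
  have hleft : (((G⁻¹ : (H →L[ℂ] H)ˣ) * D) * D - 1 : H →L[ℂ] H).toLinearMap.HasFiniteRange := by
    have : ((G⁻¹ : (H →L[ℂ] H)ˣ) * D) * D - 1 = (G⁻¹ : (H →L[ℂ] H)ˣ) * F := by
      rw [mul_assoc, hsq, mul_add, Units.inv_mul, add_sub_cancel_left]
    rw [this]
    exact hF.comp_left _
  refine ContinuousLinearMap.IsFredholm.of_isQuasiInverse
    (v := (G⁻¹ : (H →L[ℂ] H)ˣ) * D) ⟨hfin hleft, 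
    hfin (A := D * ((G⁻¹ : (H →L[ℂ] H)ˣ) * D)) (B := 1) ?_⟩
  -- With `L = G⁻¹ D` and `R = D G⁻¹`: `D L - 1 = D (L D - 1) R - D L (D R - 1) + (D R - 1)`.
  have key : D * ((G⁻¹ : (H →L[ℂ] H)ˣ) * D) - 1 =
      D * ((((G⁻¹ : (H →L[ℂ] H)ˣ) * D) * D - 1) * (D * (G⁻¹ : (H →L[ℂ] H)ˣ)))
        - (D * ((G⁻¹ : (H →L[ℂ] H)ˣ) * D)) * (D * (D * (G⁻¹ : (H →L[ℂ] H)ˣ)) - 1)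
        + (D * (D * (G⁻¹ : (H →L[ℂ] H)ˣ)) - 1) := by
    noncomm_ring
  change (D * ((G⁻¹ : (H →L[ℂ] H)ˣ) * D) - 1 : H →L[ℂ] H).toLinearMap.HasFiniteRange
  rw [key]
  exact (((hleft.comp_right _).comp_left D.toLinearMap).sub (hright.comp_left _)).add hright

/-- The Dirac operator of commuting `T_1, …, T_d` satisfies
`D² = ∑ T_k T_k* ⊗ 1 + ∑ [T_j*, T_k] ⊗ C_j* C_k`, by the anticommutation relations. -/
lemma dirac_mul_dirac [CompleteSpace H] {d : ℕ} (T : Fin d → H →L[ℂ] H)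
    (hT : ∀ j k, Commute (T j) (T k)) :
    dirac T * dirac T = TensorProduct.mapL (∑ k, T k * star (T k)) 1 +
      ∑ j, ∑ k, TensorProduct.mapL (star (T j) * T k - T k * star (T j))
        (star (creation j) * creation k) := by
  let B : H ⊗[ℂ] Exterior d →L[ℂ] H ⊗[ℂ] Exterior d := ∑ k, TensorProduct.mapL (T k) (creation k)
  have hBstar : star B = ∑ k, TensorProduct.mapL (star (T k)) (star (creation k)) := by
    simp only [B, ContinuousLinearMap.star_eq_adjoint, map_sum, TensorProduct.adjoint_mapL]
  have hD : dirac T = B + star B := rfl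
  have hBB : B * B = 0 := by
    have h : B * B = -(B * B) := by
      simp only [B, Finset.sum_mul_sum, ← TensorProduct.mapL_mul]
      conv_lhs => rw [Finset.sum_comm]
      simp only [← Finset.sum_neg_distrib]
      refine Finset.sum_congr rfl fun j _ => Finset.sum_congr rfl fun k _ => ?_
      rw [creation_mul_creation k j, (hT k j).eq]
      refine eq_neg_of_add_eq_zero_left ?_
      rw [← TensorProduct.mapL_add_right, neg_add_cancel, TensorProduct.mapL_zero_right]
    ext x
    have hx : B (B x) = -B (B x) := congrArg (fun A => A x) h
    have h2 : (2 : ℂ) • B (B x) = 0 := by rw [two_smul, ← sub_neg_eq_add, ← hx, sub_self]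
    exact (smul_eq_zero.1 h2).resolve_left two_ne_zero
  have hBB' : star B * star B = 0 := by
    have := ContinuousLinearMap.adjoint_comp B B
    change ContinuousLinearMap.adjoint (B * B) = star B * star B at this
    rw [← this, hBB, map_zero]
  have hsum : B * star B = ∑ j, ∑ k, TensorProduct.mapL (T k * star (T j))
      (creation k * star (creation j)) := by
    rw [hBstar, Finset.sum_mul_sum, Finset.sum_comm]
    simp only [← TensorProduct.mapL_mul]
  have hsum' : star B * B = ∑ j, ∑ k, TensorProduct.mapL (star (T j) * T k)
      (star (creation j) * creation k) := by
    rw [hBstar, Finset.sum_mul_sum]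
    simp only [← TensorProduct.mapL_mul]
  have hdiag : TensorProduct.mapL (∑ k, T k * star (T k)) (1 : Exterior d →L[ℂ] Exterior d) =
      ∑ j, ∑ k, TensorProduct.mapL (T k * star (T j))
        (star (creation j) * creation k + creation k * star (creation j)) := by
    have hmap : ∀ A : Fin d → H →L[ℂ] H, TensorProduct.mapL (∑ k, A k)
        (1 : Exterior d →L[ℂ] Exterior d) = ∑ k, TensorProduct.mapL (A k) 1 := fun A =>
      map_sum (AddMonoidHom.mk' (fun a : H →L[ℂ] H => TensorProduct.mapL a
        (1 : Exterior d →L[ℂ] Exterior d)) fun a b => TensorProduct.mapL_add_left a b 1) A _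
    rw [hmap]
    refine Finset.sum_congr rfl fun j _ => ?_
    rw [Finset.sum_eq_single j]
    · rw [adjoint_creation_mul_creation, if_pos rfl]
    · intro k _ hk
      rw [adjoint_creation_mul_creation, if_neg hk.symm, TensorProduct.mapL_zero_right]
    · simp
  rw [hD, mul_add, add_mul, add_mul, hBB, hBB', zero_add, add_zero, hsum, hsum', hdiag]
  simp only [← Finset.sum_add_distrib]
  refine Finset.sum_congr rfl fun j _ => Finset.sum_congr rfl fun k _ => ?_
  have hsplit : TensorProduct.mapL (star (T j) * T k) (star (creation j) * creation k) =
      TensorProduct.mapL (star (T j) * T k - T k * star (T j)) (star (creation j) * creation k) +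
        TensorProduct.mapL (T k * star (T j)) (star (creation j) * creation k) := by
    rw [← TensorProduct.mapL_add_left, sub_add_cancel]
  rw [TensorProduct.mapL_add_right, hsplit]
  abel

end Fredholm

/-! ### Coordinates on the space of vector-valued power series -/

section Coordinates

variable {d r : ℕ}

/-- The total degree `|n| = n_1 + ⋯ + n_d` of a multi-index. -/
def multiDegree (n : Fin d →₀ ℕ) : ℕ := ∑ k, n k

lemma multiDegree_add_single (n : Fin d →₀ ℕ) (k : Fin d) :
    multiDegree (n + Finsupp.single k 1) = multiDegree n + 1 := by
  simp [multiDegree, Finset.sum_add_distrib, Finsupp.single_apply]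

lemma le_multiDegree (n : Fin d →₀ ℕ) (k : Fin d) : n k ≤ multiDegree n :=
  Finset.single_le_sum (f := fun j => n j) (fun _ _ => Nat.zero_le _) (Finset.mem_univ k)

/-- The weight `√((n_k + 1) / (|n| + 1))` by which `S_k` maps the unit vector in the direction of
`z^n` to the one in the direction of `z_k z^n`. -/
def shiftWeight (k : Fin d) (n : Fin d →₀ ℕ) : ℝ :=
  Real.sqrt (((n k : ℝ) + 1) / ((multiDegree n : ℝ) + 1))

lemma weight_add_single (k : Fin d) (n : Fin d →₀ ℕ) :
    weight (n + Finsupp.single k 1) = ((n k : ℝ) + 1) / ((multiDegree n : ℝ) + 1) * weight n := by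
  classical
  have hprod : ∏ j, (Nat.factorial ((n + Finsupp.single k 1 : Fin d →₀ ℕ) j) : ℝ) =
      (n k + 1 : ℝ) * ∏ j, (Nat.factorial (n j) : ℝ) := by
    rw [← Finset.mul_prod_erase _ _ (Finset.mem_univ k),
      ← Finset.mul_prod_erase _ (fun j => (Nat.factorial (n j) : ℝ)) (Finset.mem_univ k),
      ← mul_assoc]
    congr 1
    · simp [Nat.factorial_succ]
    · refine Finset.prod_congr rfl fun j hj => ?_
      simp [(Finset.ne_of_mem_erase hj).symm]
  have hsum : ∑ j, (n + Finsupp.single k 1 : Fin d →₀ ℕ) j = multiDegree n + 1 :=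
    multiDegree_add_single n k
  rw [weight, weight, hprod, hsum, Nat.factorial_succ, Nat.cast_mul, mul_div_mul_comm,
    Nat.cast_add_one]
  rfl

lemma sqrt_weight_add_single (k : Fin d) (n : Fin d →₀ ℕ) :
    Real.sqrt (weight (n + Finsupp.single k 1)) = shiftWeight k n * Real.sqrt (weight n) := by
  rw [weight_add_single, Real.sqrt_mul (by positivity), shiftWeight]

lemma sqrt_weight_ne_zero (n : Fin d →₀ ℕ) : (Real.sqrt (weight n) : ℂ) ≠ 0 := by
  exact_mod_cast (Real.sqrt_pos.2 (weight_pos n)).ne'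

/-- The unit vector `z^n / ‖z^n‖` of `H²`. -/
def unitMonomial (n : Fin d →₀ ℕ) : H2 d := (Real.sqrt (weight n) : ℂ)⁻¹ • H2.monomial n

lemma toEll2_unitMonomial (n : Fin d →₀ ℕ) :
    toEll2 d (unitMonomial n) = lp.single 2 n (1 : ℂ) := by
  classical
  rw [unitMonomial, map_smul]
  ext m
  change (Real.sqrt (weight n) : ℂ)⁻¹ * ((Real.sqrt (weight m) : ℂ) *
    MvPowerSeries.coeff m (MvPowerSeries.monomial n 1)) = _
  rw [MvPowerSeries.coeff_monomial, lp.single_apply]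
  by_cases h : m = n
  · subst h
    simpa using inv_mul_cancel₀ (sqrt_weight_ne_zero m)
  · simp [h]

lemma inner_unitMonomial (n : Fin d →₀ ℕ) (f : H2 d) :
    inner ℂ (unitMonomial n) f = weightedCoeff f.1 n := by
  change inner ℂ (toEll2 d (unitMonomial n)) (toEll2 d f) = _
  rw [toEll2_unitMonomial, lp.inner_single_left]
  simp [toEll2]

lemma shift_monomial (k : Fin d) (n : Fin d →₀ ℕ) :
    shift k (H2.monomial n) = H2.monomial (n + Finsupp.single k 1) := by
  apply Subtype.ext
  change MvPowerSeries.X k * MvPowerSeries.monomial n 1 = MvPowerSeries.monomial _ 1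
  rw [MvPowerSeries.X, MvPowerSeries.monomial_mul_monomial, one_mul, add_comm]

lemma shiftWeight_ne_zero (k : Fin d) (n : Fin d →₀ ℕ) : (shiftWeight k n : ℂ) ≠ 0 := by
  have : 0 < shiftWeight k n := Real.sqrt_pos.2 (by positivity)
  exact_mod_cast this.ne'

lemma shift_unitMonomial (k : Fin d) (n : Fin d →₀ ℕ) :
    shift k (unitMonomial n) = (shiftWeight k n : ℂ) • unitMonomial (n + Finsupp.single k 1) := by
  rw [unitMonomial, map_smul, shift_monomial, unitMonomial, smul_smul, sqrt_weight_add_single,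
    Complex.ofReal_mul, mul_inv, mul_inv_cancel_left₀ (shiftWeight_ne_zero k n)]

lemma weightedCoeff_shift (k : Fin d) (n : Fin d →₀ ℕ) (f : H2 d) :
    weightedCoeff (shift k f).1 (n + Finsupp.single k 1) =
      (shiftWeight k n : ℂ) * weightedCoeff f.1 n := by
  change (Real.sqrt _ : ℂ) * MvPowerSeries.coeff _ (MvPowerSeries.X k * f.1) = _
  rw [add_comm n, MvPowerSeries.X, MvPowerSeries.coeff_add_monomial_mul, one_mul, add_comm _ n,
    sqrt_weight_add_single, Complex.ofReal_mul, mul_assoc]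
  rfl

lemma weightedCoeff_shift_of_eq_zero {k : Fin d} {n : Fin d →₀ ℕ} (hn : n k = 0) (f : H2 d) :
    weightedCoeff (shift k f).1 n = 0 := by
  classical
  change (Real.sqrt _ : ℂ) * MvPowerSeries.coeff _ (MvPowerSeries.X k * f.1) = _
  have hle : ¬ Finsupp.single k 1 ≤ n := fun h => by
    have := h k
    rw [Finsupp.single_eq_same, hn] at this
    exact Nat.not_succ_le_zero 0 this
  rw [MvPowerSeries.X, MvPowerSeries.coeff_monomial_mul, if_neg hle, mul_zero]

/-- The embedding `ζ ↦ z^n / ‖z^n‖ ⊗ ζ` of `ℂ^r` as the space of monomials of exponent `n`. -/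
def embedding (r : ℕ) (n : Fin d →₀ ℕ) : EuclideanSpace ℂ (Fin r) →L[ℂ] H2Vec d r :=
  (TensorProduct.mkL ℂ (H2 d) (EuclideanSpace ℂ (Fin r)) (unitMonomial n) :
    EuclideanSpace ℂ (Fin r) →L[ℂ] H2 d ⊗[ℂ] EuclideanSpace ℂ (Fin r))

/-- The `n`th coordinate of an element of `H² ⊗ ℂ^r`, for the orthogonal decomposition into the
spaces `z^n ⊗ ℂ^r`. -/
def coordinate (r : ℕ) (n : Fin d →₀ ℕ) : H2Vec d r →L[ℂ] EuclideanSpace ℂ (Fin r) :=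
  ContinuousLinearMap.adjoint (embedding r n)

lemma embedding_apply (n : Fin d →₀ ℕ) (ζ : EuclideanSpace ℂ (Fin r)) :
    embedding r n ζ = H2Vec.tmul (unitMonomial n) ζ := rfl

lemma vecShift_tmul (k : Fin d) (f : H2 d) (ζ : EuclideanSpace ℂ (Fin r)) :
    vecShift d r k (H2Vec.tmul f ζ) = H2Vec.tmul (shift k f) ζ := rfl

lemma inner_tmul (f g : H2 d) (ζ η : EuclideanSpace ℂ (Fin r)) :
    inner ℂ (H2Vec.tmul f ζ) (H2Vec.tmul g η) = inner ℂ f g * inner ℂ ζ η :=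
  TensorProduct.inner_tmul (𝕜 := ℂ) f g ζ η

lemma coordinate_tmul (n : Fin d →₀ ℕ) (f : H2 d) (ζ : EuclideanSpace ℂ (Fin r)) :
    coordinate r n (H2Vec.tmul f ζ) = weightedCoeff f.1 n • ζ := by
  refine ext_inner_left ℂ fun v => ?_
  rw [coordinate, ContinuousLinearMap.adjoint_inner_right, embedding_apply, inner_tmul,
    inner_unitMonomial, inner_smul_right]

lemma H2Vec.induction_on {P : H2Vec d r → Prop} (ξ : H2Vec d r) (zero : P 0)
    (tmul : ∀ f ζ, P (H2Vec.tmul f ζ)) (add : ∀ ξ η, P ξ → P η → P (ξ + η)) : P ξ :=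
  TensorProduct.induction_on (motive := P) ξ zero tmul add

lemma H2Vec.smul_tmul (c : ℂ) (f : H2 d) (ζ : EuclideanSpace ℂ (Fin r)) :
    H2Vec.tmul (c • f) ζ = c • H2Vec.tmul f ζ :=
  rfl

lemma vecShift_embedding (k : Fin d) (n : Fin d →₀ ℕ) (ζ : EuclideanSpace ℂ (Fin r)) :
    vecShift d r k (embedding r n ζ) =
      (shiftWeight k n : ℂ) • embedding r (n + Finsupp.single k 1) ζ := by
  rw [embedding_apply, embedding_apply, vecShift_tmul, shift_unitMonomial, H2Vec.smul_tmul]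

lemma coordinate_vecShift (k : Fin d) (n : Fin d →₀ ℕ) (ξ : H2Vec d r) :
    coordinate r (n + Finsupp.single k 1) (vecShift d r k ξ) =
      (shiftWeight k n : ℂ) • coordinate r n ξ := by
  induction ξ using H2Vec.induction_on with
  | zero => simp
  | tmul f ζ =>
    rw [vecShift_tmul, coordinate_tmul, coordinate_tmul, weightedCoeff_shift, mul_smul]
  | add ξ η h h' => rw [map_add, map_add, h, h', map_add, smul_add]

lemma coordinate_vecShift_of_eq_zero {k : Fin d} {n : Fin d →₀ ℕ} (hn : n k = 0)
    (ξ : H2Vec d r) : coordinate r n (vecShift d r k ξ) = 0 := by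
  induction ξ using H2Vec.induction_on with
  | zero => simp
  | tmul f ζ =>
    rw [vecShift_tmul, coordinate_tmul, weightedCoeff_shift_of_eq_zero hn, zero_smul]
  | add ξ η h h' => rw [map_add, map_add, h, h', add_zero]

lemma coordinate_adjoint_vecShift (k : Fin d) (n : Fin d →₀ ℕ) (ξ : H2Vec d r) :
    coordinate r n (ContinuousLinearMap.adjoint (vecShift d r k) ξ) =
      (shiftWeight k n : ℂ) • coordinate r (n + Finsupp.single k 1) ξ := by
  refine ext_inner_left ℂ fun v => ?_
  rw [coordinate, ContinuousLinearMap.adjoint_inner_right, ContinuousLinearMap.adjoint_inner_right,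
    vecShift_embedding, inner_smul_left, inner_smul_right, coordinate,
    ContinuousLinearMap.adjoint_inner_right, Complex.conj_ofReal]

lemma hasSum_norm_weightedCoeff_sq (f : H2 d) :
    HasSum (fun n => ‖weightedCoeff f.1 n‖ ^ 2) (‖f‖ ^ 2) := by
  rw [H2.norm_sq_eq]
  simp only [norm_weightedCoeff_sq]
  exact Summable.hasSum f.2

lemma H2Vec.exists_eq_sum_tmul (ξ : H2Vec d r) : ∃ x : Fin r → H2 d,
    ξ = ∑ i, H2Vec.tmul (x i) (EuclideanSpace.basisFun (Fin r) ℂ i) := by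
  induction ξ using H2Vec.induction_on with
  | zero => exact ⟨0, (Finset.sum_eq_zero fun i _ => TensorProduct.zero_tmul _ _).symm⟩
  | tmul f ζ =>
    refine ⟨fun i => ζ i • f, ?_⟩
    conv_lhs => rw [← (EuclideanSpace.basisFun (Fin r) ℂ).sum_repr ζ]
    refine (TensorProduct.tmul_sum f _ _).trans (Finset.sum_congr rfl fun i _ => ?_)
    exact (TensorProduct.smul_tmul _ _ _).symm
  | add ξ η h h' =>
    obtain ⟨x, rfl⟩ := h
    obtain ⟨y, rfl⟩ := h'
    refine ⟨x + y, ?_⟩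
    rw [← Finset.sum_add_distrib]
    exact Finset.sum_congr rfl fun i _ => (TensorProduct.add_tmul _ _ _).symm

/-- Parseval's identity for the orthogonal decomposition into the spaces `z^n ⊗ ℂ^r`. -/
lemma hasSum_norm_coordinate_sq (ξ : H2Vec d r) :
    HasSum (fun n => ‖coordinate r n ξ‖ ^ 2) (‖ξ‖ ^ 2) := by
  obtain ⟨x, rfl⟩ := H2Vec.exists_eq_sum_tmul ξ
  have hnorm : ‖∑ i, H2Vec.tmul (x i) (EuclideanSpace.basisFun (Fin r) ℂ i)‖ ^ 2 =
      ∑ i, ‖x i‖ ^ 2 := by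
    have h := (tensorIsometry (H := H2 d) (EuclideanSpace.basisFun (Fin r) ℂ)).norm_map
      (WithLp.toLp 2 x)
    have h2 := PiLp.norm_sq_eq_of_L2 (fun _ : Fin r => H2 d) (WithLp.toLp 2 x)
    rw [← h] at h2
    exact h2
  have hcoord : ∀ n, ‖coordinate r n
      (∑ i, H2Vec.tmul (x i) (EuclideanSpace.basisFun (Fin r) ℂ i))‖ ^ 2 =
        ∑ i, ‖weightedCoeff (x i).1 n‖ ^ 2 := by
    intro n
    rw [map_sum]
    simp only [coordinate_tmul]
    rw [EuclideanSpace.norm_sq_eq]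
    simp [Pi.single_apply]
  rw [hnorm]
  simp only [hcoord]
  exact hasSum_sum fun i _ => hasSum_norm_weightedCoeff_sq (x i)

lemma commute_vecShift (j k : Fin d) : Commute (vecShift d r j) (vecShift d r k) := by
  ext ξ
  change vecShift d r j (vecShift d r k ξ) = vecShift d r k (vecShift d r j ξ)
  induction ξ using H2Vec.induction_on with
  | zero => simp
  | tmul f ζ =>
    simp only [vecShift_tmul]
    exact congrArg (H2Vec.tmul · ζ) (Subtype.ext (mul_left_comm _ _ _))
  | add ξ η h h' => simp only [map_add, h, h']

end Coordinates

/-! ### Truncation of operators in coordinates -/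

section Truncation

variable {d r : ℕ} {K : Type*} [NormedAddCommGroup K] [InnerProductSpace ℂ K] [CompleteSpace K]

lemma finrank_range_le_of_ker_le_ker {V V' W : Type*} [AddCommGroup V] [Module ℂ V] [AddCommGroup V']
    [Module ℂ V'] [AddCommGroup W] [Module ℂ W] [FiniteDimensional ℂ W] (f : V →ₗ[ℂ] W)
    (g : V →ₗ[ℂ] V') (h : LinearMap.ker f ≤ LinearMap.ker g) : g.HasFiniteRange ∧
      Module.finrank ℂ (LinearMap.range g) ≤ Module.finrank ℂ W := by
  have : FiniteDimensional ℂ (V ⧸ LinearMap.ker f) := f.quotKerEquivRange.symm.finiteDimensional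
  have hrange : LinearMap.range g = LinearMap.range ((LinearMap.ker f).liftQ g h) :=
    (Submodule.range_liftQ _ _ _).symm
  constructor
  · rw [LinearMap.hasFiniteRange_iff_range, hrange, ← Module.Finite.iff_fg]
    infer_instance
  · rw [hrange]
    refine (LinearMap.finrank_range_le _).trans ?_
    rw [f.quotKerEquivRange.finrank_eq]
    exact Submodule.finrank_le _

/-- There are at most `N ^ d` multi-indices of degree less than `N`. Hence the condition that the
coordinates of degree less than `N` vanish cuts out a subspace of codimension at most `r N ^ d`, and
cutting `A` down to this subspace changes it by an operator of at most that rank. -/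
lemma inWeakSchatten_of_norm_le (Q : (Fin d →₀ ℕ) → K →L[ℂ] EuclideanSpace ℂ (Fin r))
    (A : K →L[ℂ] K) {c : ℝ} (hc : 0 ≤ c)
    (hA : ∀ (N : ℕ) (ξ : K), (∀ n, multiDegree n < N → Q n ξ = 0) →
      ‖A ξ‖ ≤ c / (N + 1) * ‖ξ‖) : InWeakSchatten d A := by
  refine ⟨c, r, fun N => ?_⟩
  let Φ : K →L[ℂ] ((Fin d → Fin N) → EuclideanSpace ℂ (Fin r)) :=
    ContinuousLinearMap.pi fun i => Q (Finsupp.equivFunOnFinite.symm fun k => (i k : ℕ))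
  let L : Submodule ℂ K := LinearMap.ker Φ.toLinearMap
  have : CompleteSpace L := (ContinuousLinearMap.isClosed_ker Φ).completeSpace_coe
  have hL : ∀ ξ ∈ L, ‖A ξ‖ ≤ c / (N + 1) * ‖ξ‖ := by
    intro ξ hξ
    refine hA N ξ fun n hn => ?_
    have h : Φ ξ = 0 := hξ
    have h' := congrFun h fun k => ⟨n k, (le_multiDegree n k).trans_lt hn⟩
    simpa [Φ] using h'
  have hker : L ≤ LinearMap.ker (A - A * L.starProjection).toLinearMap := by
    intro ξ hξ
    have : L.starProjection ξ = ξ := Submodule.starProjection_eq_self_iff.2 hξ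
    simp [this]
  obtain ⟨hfin, hrank⟩ := finrank_range_le_of_ker_le_ker Φ.toLinearMap _ hker
  refine ⟨A - A * L.starProjection, ?_, ?_⟩
  · have := Module.Finite.iff_fg.2 hfin.fg_range
    rw [LinearMap.rank, ← Module.finrank_eq_rank]
    refine Nat.cast_le.2 (hrank.trans ?_)
    simp [Module.finrank_pi_fintype, mul_comm]
  · rw [sub_sub_cancel]
    refine ContinuousLinearMap.opNorm_le_bound _ (by positivity) fun ξ => ?_
    refine (hL _ (Submodule.starProjection_apply_mem L ξ)).trans ?_
    exact mul_le_mul_of_nonneg_left (L.norm_starProjection_apply_le ξ) (by positivity)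

/-- An operator that maps the `n`th coordinate space to the one of index `n + e_j - e_k`, with norm
`O(1 / |n|)`, belongs to the weak Schatten class. -/
lemma inWeakSchatten_of_coordinate (Q : (Fin d →₀ ℕ) → K →L[ℂ] EuclideanSpace ℂ (Fin r))
    (hQ : ∀ ξ, HasSum (fun n => ‖Q n ξ‖ ^ 2) (‖ξ‖ ^ 2)) (A : K →L[ℂ] K) {c : ℝ} (hc : 0 ≤ c)
    (j k : Fin d)
    (h0 : ∀ m ξ, ¬ Finsupp.single j 1 ≤ m + Finsupp.single k 1 → Q m (A ξ) = 0)
    (h : ∀ m n ξ, m + Finsupp.single k 1 = n + Finsupp.single j 1 →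
      ‖Q m (A ξ)‖ ≤ c / (multiDegree n + 1) * ‖Q n ξ‖) : InWeakSchatten d A := by
  refine inWeakSchatten_of_norm_le Q A hc fun N ξ hξ => ?_
  let S : Set (Fin d →₀ ℕ) := {m | Finsupp.single j 1 ≤ m + Finsupp.single k 1}
  let τ : S → Fin d →₀ ℕ := fun m => (m : Fin d →₀ ℕ) + Finsupp.single k 1 - Finsupp.single j 1
  have hτ : ∀ m : S, (m : Fin d →₀ ℕ) + Finsupp.single k 1 = τ m + Finsupp.single j 1 :=
    fun m => (tsub_add_cancel_of_le m.2).symm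
  have hinj : Function.Injective τ := fun m m' hm => by
    have := (hτ m).trans ((congrArg (· + Finsupp.single j 1) hm).trans (hτ m').symm)
    exact Subtype.ext (add_right_cancel this)
  have hsupp : Function.support (fun m => ‖Q m (A ξ)‖ ^ 2) ⊆ S := by
    intro m hm
    by_contra hmS
    exact hm (by simp [h0 m ξ hmS])
  have hsum := (hasSum_subtype_iff_of_support_subset hsupp).2 (hQ (A ξ))
  have hle : ‖A ξ‖ ^ 2 ≤ (c / (N + 1)) ^ 2 * ‖ξ‖ ^ 2 := by
    refine hasSum_le_inj τ hinj (fun _ _ => by positivity) (fun m => ?_) hsum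
      ((hQ ξ).mul_left ((c / (N + 1)) ^ 2))
    change ‖Q m (A ξ)‖ ^ 2 ≤ _
    rw [← mul_pow]
    refine pow_le_pow_left₀ (norm_nonneg _) ((h m (τ m) ξ (hτ m)).trans ?_) 2
    by_cases hN : multiDegree (τ m) < N
    · simp [hξ _ hN]
    · have : (N : ℝ) ≤ multiDegree (τ m) := by exact_mod_cast not_lt.1 hN
      gcongr
  rw [← mul_pow] at hle
  exact (sq_le_sq₀ (norm_nonneg _) (by positivity)).1 hle

end Truncation

/-! ### Monotone families of subspaces indexed by exponents -/

section Noetherian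

/-- A monotone family of subspaces of a finite-dimensional space, indexed by `ℕ^d`, is constant in
the `k`th direction from some bound `N` on the `k`th exponent on. By Dickson's lemma a sequence of
multi-indices `n` with `n_k → ∞` and `V (n + e_k) ≠ V n` would contain an increasing one, along
which `V` becomes stationary. -/
lemma exists_bound_of_monotone {d : ℕ} {E : Type*} [AddCommGroup E] [Module ℂ E]
    [FiniteDimensional ℂ E] (V : (Fin d →₀ ℕ) → Submodule ℂ E) (hV : Monotone V) :
    ∃ N : ℕ, ∀ k n, N ≤ n k → V (n + Finsupp.single k 1) = V n := by
  have hstep : ∀ k (n : Fin d →₀ ℕ), n ≤ n + Finsupp.single k 1 := fun k n => le_self_add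
  have hk : ∀ k, ∃ N : ℕ, ∀ n, N ≤ n k → V (n + Finsupp.single k 1) = V n := by
    intro k
    by_contra! h
    choose f hf hVf using h
    obtain ⟨g, hg⟩ := (wellQuasiOrdered_le (α := Fin d →₀ ℕ)).exists_monotone_subseq f
    obtain ⟨i, hi⟩ := WellFoundedGT.monotone_chain_condition
      (⟨fun i => V (f (g i)), fun a b hab => hV (hg a b hab)⟩ : ℕ →o Submodule ℂ E)
    let m := max i (f (g i) k + 1)
    have hle : f (g i) + Finsupp.single k 1 ≤ f (g m) := by
      intro j
      by_cases hj : j = k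
      · subst hj
        have : f (g i) j + 1 ≤ f (g m) j :=
          (le_max_right _ _).trans ((g.strictMono.le_apply (x := m)).trans (hf (g m)))
        simpa using this
      · simpa [Finsupp.single_apply, Ne.symm hj] using hg i m (le_max_left _ _) j
    refine hVf (g i) (le_antisymm ?_ (hV (hstep k _)))
    exact (hV hle).trans (hi m (le_max_left _ _)).ge
  choose N hN using hk
  exact ⟨Finset.univ.sup N, fun k n hn => hN k n ((Finset.le_sup (Finset.mem_univ k)).trans hn)⟩

end Noetherian

/-! ### Monomial submodules and compressed shifts -/

section MonomialSubmodule

variable {d r : ℕ}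

/-- A closed shift-invariant subspace of `H² ⊗ ℂ^r` that is the closed linear span of the monomials
it contains: with every vector it contains the components of this vector in the orthogonal
decomposition into the spaces `z^n ⊗ ℂ^r`. -/
structure IsMonomialSubmodule (M : Submodule ℂ (H2Vec d r)) : Prop where
  isClosed : IsClosed (M : Set (H2Vec d r))
  vecShift_mem : ∀ k, ∀ ξ ∈ M, vecShift d r k ξ ∈ M
  component_mem : ∀ n, ∀ ξ ∈ M, embedding r n (coordinate r n ξ) ∈ M

lemma weightedCoeff_monomial (n m : Fin d →₀ ℕ) :
    weightedCoeff (H2.monomial m).1 n = if n = m then (Real.sqrt (weight m) : ℂ) else 0 := by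
  classical
  change (Real.sqrt (weight n) : ℂ) * MvPowerSeries.coeff n (MvPowerSeries.monomial m 1) = _
  rw [MvPowerSeries.coeff_monomial]
  by_cases h : n = m <;> simp [h]

lemma embedding_coordinate_monomial (n m : Fin d →₀ ℕ) (ζ : EuclideanSpace ℂ (Fin r)) :
    embedding r n (coordinate r n (H2Vec.tmul (H2.monomial m) ζ)) =
      if n = m then H2Vec.tmul (H2.monomial m) ζ else 0 := by
  rw [coordinate_tmul, weightedCoeff_monomial]
  split_ifs with h
  · subst h
    rw [map_smul, embedding_apply, unitMonomial, H2Vec.smul_tmul, smul_smul,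
      mul_inv_cancel₀ (sqrt_weight_ne_zero n), one_smul]
  · rw [zero_smul, map_zero]

lemma closedInvariantSpan_le {X : Set (H2Vec d r)} {N : Submodule ℂ (H2Vec d r)}
    (hN : IsClosed (N : Set (H2Vec d r))) (hXN : X ⊆ N)
    (hinv : ∀ k, ∀ ξ ∈ N, vecShift d r k ξ ∈ N) :
    closedInvariantSpan (vecShift d r) X ≤ N :=
  sInf_le ⟨hN, hXN, hinv⟩

/-- The vectors of `M` all of whose components are in `M` form a closed invariant subspace which
contains the generators. -/
lemma isMonomialSubmodule_closedInvariantSpan {X : Set (H2Vec d r)} (hX : X ⊆ monomials d r) :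
    IsMonomialSubmodule (closedInvariantSpan (vecShift d r) X) := by
  set M := closedInvariantSpan (vecShift d r) X with hM
  have hclosed : IsClosed (M : Set (H2Vec d r)) := by
    rw [hM, closedInvariantSpan, Submodule.coe_sInf]
    exact isClosed_biInter fun N hN => hN.1
  have hXM : X ⊆ M := fun ξ hξ => Submodule.mem_sInf.2 fun N hN => hN.2.1 hξ
  have hinv : ∀ k, ∀ ξ ∈ M, vecShift d r k ξ ∈ M := fun k ξ hξ =>
    Submodule.mem_sInf.2 fun N hN => hN.2.2 k ξ (Submodule.mem_sInf.1 hξ N hN)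
  let N : Submodule ℂ (H2Vec d r) :=
    M ⊓ ⨅ n, M.comap ((embedding r n).comp (coordinate r n)).toLinearMap
  have hmem : ∀ ξ, ξ ∈ N ↔ ξ ∈ M ∧ ∀ n, embedding r n (coordinate r n ξ) ∈ M := fun ξ => by
    simp [N]
  have hle : M ≤ N := by
    refine closedInvariantSpan_le ?_ ?_ ?_
    · have : (N : Set (H2Vec d r)) =
          (M : Set (H2Vec d r)) ∩
            ⋂ n, (fun ξ => embedding r n (coordinate r n ξ)) ⁻¹' (M : Set (H2Vec d r)) := by
        ext ξ
        simp [hmem]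
      rw [this]
      exact hclosed.inter (isClosed_iInter fun n =>
        hclosed.preimage ((embedding r n).comp (coordinate r n)).continuous)
    · intro ξ hξ
      refine (hmem ξ).2 ⟨hXM hξ, fun n => ?_⟩
      obtain ⟨m, ζ, rfl⟩ := hX hξ
      rw [embedding_coordinate_monomial]
      split_ifs
      · exact hXM hξ
      · exact M.zero_mem
    · intro k ξ hξ
      obtain ⟨hξM, hξn⟩ := (hmem ξ).1 hξ
      refine (hmem _).2 ⟨hinv k ξ hξM, fun n => ?_⟩
      by_cases hn : n k = 0
      · rw [coordinate_vecShift_of_eq_zero hn, map_zero]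
        exact M.zero_mem
      · obtain ⟨l, rfl⟩ : ∃ l, n = l + Finsupp.single k 1 :=
          ⟨n - Finsupp.single k 1, (tsub_add_cancel_of_le
            (Finsupp.single_le_iff.2 (Nat.one_le_iff_ne_zero.2 hn))).symm⟩
        rw [coordinate_vecShift, map_smul, ← vecShift_embedding]
        exact hinv k _ (hξn l)
  exact ⟨hclosed, hinv, fun n ξ hξ => ((hmem ξ).1 (hle hξ)).2 n⟩

/-- The space `V_n ⊆ ℂ^r` of all `ζ` such that `z^n ⊗ ζ` belongs to `M`. -/
def fiber (M : Submodule ℂ (H2Vec d r)) (n : Fin d →₀ ℕ) : Submodule ℂ (EuclideanSpace ℂ (Fin r)) :=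
  M.comap (embedding r n).toLinearMap

/-- The orthogonal projection of `ℂ^r` onto `V_n^⊥`. -/
def fiberProjection (M : Submodule ℂ (H2Vec d r)) (n : Fin d →₀ ℕ) :
    EuclideanSpace ℂ (Fin r) →L[ℂ] EuclideanSpace ℂ (Fin r) :=
  (fiber M n)ᗮ.starProjection

/-- The compression of the `d`-shift to the orthogonal complement of `M`. -/
def compressedShift (M : Submodule ℂ (H2Vec d r)) (k : Fin d) : Mᗮ →L[ℂ] Mᗮ :=
  compression Mᗮ (vecShift d r k)

/-- The `n`th coordinate on the orthogonal complement of `M`. -/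
def coordinateOn (M : Submodule ℂ (H2Vec d r)) (n : Fin d →₀ ℕ) :
    Mᗮ →L[ℂ] EuclideanSpace ℂ (Fin r) :=
  coordinate r n ∘L Mᗮ.subtypeL

namespace IsMonomialSubmodule

variable {M : Submodule ℂ (H2Vec d r)}

lemma fiber_mono (hM : IsMonomialSubmodule M) : Monotone (fiber M) := by
  have hstep : ∀ n k, fiber M n ≤ fiber M (n + Finsupp.single k 1) := by
    intro n k ζ hζ
    have h : vecShift d r k (embedding r n ζ) ∈ M := hM.vecShift_mem k _ hζ
    rw [vecShift_embedding] at h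
    exact (M.smul_mem_iff (shiftWeight_ne_zero k n)).1 h
  have hadd : ∀ s n : Fin d →₀ ℕ, fiber M n ≤ fiber M (n + s) := by
    intro s
    induction s using Finsupp.induction_linear with
    | zero => intro n; rw [add_zero]
    | add f g hf hg => intro n; rw [← add_assoc]; exact (hf n).trans (hg _)
    | single k b =>
      induction b with
      | zero => intro n; rw [Finsupp.single_zero, add_zero]
      | succ b ih => intro n; rw [Finsupp.single_add, ← add_assoc]; exact (ih n).trans (hstep _ _)
  intro n m hnm
  rw [← add_tsub_cancel_of_le hnm]
  exact hadd _ n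

lemma coordinate_mem_fiber (hM : IsMonomialSubmodule M) {ξ : H2Vec d r} (hξ : ξ ∈ M)
    (n : Fin d →₀ ℕ) : coordinate r n ξ ∈ fiber M n :=
  hM.component_mem n ξ hξ

end IsMonomialSubmodule

variable {M : Submodule ℂ (H2Vec d r)}

lemma coordinate_mem_orthogonal_fiber {ξ : H2Vec d r} (hξ : ξ ∈ Mᗮ) (n : Fin d →₀ ℕ) :
    coordinate r n ξ ∈ (fiber M n)ᗮ := by
  intro ζ hζ
  rw [coordinate, ContinuousLinearMap.adjoint_inner_right]
  exact hξ _ hζ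

lemma fiberProjection_eq_self {n : Fin d →₀ ℕ} {ζ : EuclideanSpace ℂ (Fin r)}
    (hζ : ζ ∈ (fiber M n)ᗮ) : fiberProjection M n ζ = ζ :=
  Submodule.starProjection_eq_self_iff.2 hζ

lemma norm_fiberProjection_le (n : Fin d →₀ ℕ) (ζ : EuclideanSpace ℂ (Fin r)) :
    ‖fiberProjection M n ζ‖ ≤ ‖ζ‖ :=
  Submodule.norm_starProjection_apply_le _ ζ

lemma coordinateOn_mem (n : Fin d →₀ ℕ) (ξ : Mᗮ) : coordinateOn M n ξ ∈ (fiber M n)ᗮ :=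
  coordinate_mem_orthogonal_fiber ξ.2 n

lemma hasSum_norm_coordinateOn_sq (ξ : Mᗮ) :
    HasSum (fun n => ‖coordinateOn M n ξ‖ ^ 2) (‖ξ‖ ^ 2) :=
  hasSum_norm_coordinate_sq (ξ : H2Vec d r)

lemma eq_zero_of_coordinateOn {ξ : Mᗮ} (h : ∀ n, coordinateOn M n ξ = 0) : ξ = 0 := by
  have h2 := hasSum_norm_coordinateOn_sq ξ
  simp only [h, norm_zero, ne_eq, OfNat.ofNat_ne_zero, not_false_eq_true, zero_pow] at h2
  exact norm_eq_zero.1 (pow_eq_zero_iff two_ne_zero |>.1 (h2.unique hasSum_zero))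

namespace IsMonomialSubmodule

lemma coordinate_orthogonalProjection (hM : IsMonomialSubmodule M) (n : Fin d →₀ ℕ)
    (ξ : H2Vec d r) : coordinateOn M n (Mᗮ.orthogonalProjectionOnto ξ) =
      fiberProjection M n (coordinate r n ξ) := by
  refine (Submodule.eq_starProjection_of_mem_orthogonal (coordinateOn_mem n _) ?_).symm
  have : CompleteSpace M := hM.isClosed.completeSpace_coe
  have h : ξ - Mᗮ.orthogonalProjectionOnto ξ ∈ M := by
    have := Mᗮ.sub_starProjection_mem_orthogonal ξ
    rwa [Submodule.orthogonal_orthogonal] at this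
  refine Submodule.le_orthogonal_orthogonal _ ?_
  change coordinate r n ξ - coordinate r n _ ∈ _
  rw [← map_sub]
  exact hM.coordinate_mem_fiber h n

lemma adjoint_vecShift_mem (hM : IsMonomialSubmodule M) (k : Fin d) {ξ : H2Vec d r}
    (hξ : ξ ∈ Mᗮ) : ContinuousLinearMap.adjoint (vecShift d r k) ξ ∈ Mᗮ := by
  intro η hη
  rw [ContinuousLinearMap.adjoint_inner_right]
  exact hξ _ (hM.vecShift_mem k η hη)

/-- The adjoint of the compression is the restriction of the adjoint. -/
lemma coe_star_compressedShift (hM : IsMonomialSubmodule M) (k : Fin d) (ξ : Mᗮ) :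
    (star (compressedShift M k) ξ : H2Vec d r) =
      ContinuousLinearMap.adjoint (vecShift d r k) ξ := by
  refine congrArg Subtype.val (a₂ := (⟨_, hM.adjoint_vecShift_mem k ξ.2⟩ : Mᗮ)) ?_
  refine ext_inner_left ℂ fun η => ?_
  rw [ContinuousLinearMap.star_eq_adjoint, ContinuousLinearMap.adjoint_inner_right]
  change inner ℂ (Mᗮ.orthogonalProjectionOnto (vecShift d r k η)) ξ =
    inner ℂ (η : H2Vec d r) (ContinuousLinearMap.adjoint (vecShift d r k) ξ)
  rw [Submodule.inner_orthogonalProjectionOnto_eq_of_mem_right,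
    ContinuousLinearMap.adjoint_inner_right]

lemma coordinateOn_compressedShift (hM : IsMonomialSubmodule M) (k : Fin d) (n : Fin d →₀ ℕ)
    (ξ : Mᗮ) : coordinateOn M (n + Finsupp.single k 1) (compressedShift M k ξ) =
      (shiftWeight k n : ℂ) •
        fiberProjection M (n + Finsupp.single k 1) (coordinateOn M n ξ) := by
  refine (hM.coordinate_orthogonalProjection _ _).trans ?_
  change fiberProjection M _ (coordinate r _ (vecShift d r k ξ)) = _
  rw [coordinate_vecShift, map_smul]
  rfl

lemma coordinateOn_compressedShift_of_eq_zero (hM : IsMonomialSubmodule M) {k : Fin d}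
    {n : Fin d →₀ ℕ} (hn : n k = 0) (ξ : Mᗮ) :
    coordinateOn M n (compressedShift M k ξ) = 0 := by
  refine (hM.coordinate_orthogonalProjection _ _).trans ?_
  change fiberProjection M _ (coordinate r _ (vecShift d r k ξ)) = _
  rw [coordinate_vecShift_of_eq_zero hn, map_zero]

lemma coordinateOn_star_compressedShift (hM : IsMonomialSubmodule M) (k : Fin d)
    (n : Fin d →₀ ℕ) (ξ : Mᗮ) : coordinateOn M n (star (compressedShift M k) ξ) =
      (shiftWeight k n : ℂ) • coordinateOn M (n + Finsupp.single k 1) ξ := by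
  change coordinate r n (star (compressedShift M k) ξ : Mᗮ) = _
  rw [hM.coe_star_compressedShift, coordinate_adjoint_vecShift]
  rfl

lemma commute_compressedShift (hM : IsMonomialSubmodule M) (j k : Fin d) :
    Commute (compressedShift M j) (compressedShift M k) := by
  rw [← commute_star_star]
  ext ξ
  change (star (compressedShift M j) (star (compressedShift M k) ξ) : Mᗮ).1 =
    (star (compressedShift M k) (star (compressedShift M j) ξ) : Mᗮ).1
  simp only [hM.coe_star_compressedShift]
  have h : Commute (star (vecShift d r j)) (star (vecShift d r k)) :=
    (commute_vecShift j k).star_star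
  exact congrArg (fun A : H2Vec d r →L[ℂ] H2Vec d r => A ξ) h.eq

end IsMonomialSubmodule

end MonomialSubmodule

/-! ### Commutators of the compressed shifts -/

section Commutators

variable {d r : ℕ}

lemma shiftWeight_nonneg (k : Fin d) (n : Fin d →₀ ℕ) : 0 ≤ shiftWeight k n := Real.sqrt_nonneg _

lemma shiftWeight_mul_self (k : Fin d) (n : Fin d →₀ ℕ) :
    shiftWeight k n * shiftWeight k n = ((n k : ℝ) + 1) / ((multiDegree n : ℝ) + 1) :=
  Real.mul_self_sqrt (by positivity)

lemma shiftWeight_mul_eq {j k : Fin d} {m n : Fin d →₀ ℕ} (h : multiDegree m = multiDegree n) :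
    shiftWeight k m * shiftWeight j n =
      Real.sqrt (((m k : ℝ) + 1) * ((n j : ℝ) + 1)) / ((multiDegree n : ℝ) + 1) := by
  rw [shiftWeight, shiftWeight, h, ← Real.sqrt_mul (by positivity), div_mul_div_comm,
    Real.sqrt_div (by positivity), Real.sqrt_mul_self (by positivity)]

lemma sqrt_mul_le {x y a : ℝ} (hx : 0 ≤ x) (hxa : x ≤ a) (hya : y ≤ a) :
    Real.sqrt (x * y) ≤ a :=
  Real.sqrt_le_iff.2 ⟨hx.trans hxa, by nlinarith⟩

/-- The weights of `S_k* S_j` and `S_j S_k*` differ by `O(1 / |n|)`. -/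
lemma abs_shiftWeight_mul_sub_le (j k : Fin d) (l : Fin d →₀ ℕ) :
    |shiftWeight j l * shiftWeight k l -
      shiftWeight k (l + Finsupp.single j 1) * shiftWeight j (l + Finsupp.single k 1)| ≤
        1 / ((multiDegree l : ℝ) + 2) := by
  have hj : (l j : ℝ) ≤ multiDegree l := by exact_mod_cast le_multiDegree l j
  have hk : (l k : ℝ) ≤ multiDegree l := by exact_mod_cast le_multiDegree l k
  rw [shiftWeight_mul_eq rfl, shiftWeight_mul_eq (by simp only [multiDegree_add_single]),
    multiDegree_add_single]
  set L : ℝ := (multiDegree l : ℝ) with hL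
  have hL0 : 0 ≤ L := Nat.cast_nonneg _
  have key : ∀ s t : ℝ, t - s = 0 ∨ t - s = 1 → 0 ≤ s → s ≤ L + 1 →
      |s / (L + 1) - t / (L + 2)| ≤ 1 / (L + 2) := by
    intro s t hst hs hsL
    have h : s / (L + 1) - t / (L + 2) = (s / (L + 1) - (t - s)) / (L + 2) := by
      field_simp
      ring
    have h0 : 0 ≤ s / (L + 1) := by positivity
    have h1 : s / (L + 1) ≤ 1 := (div_le_one (by positivity)).2 hsL
    rw [h, abs_div, abs_of_pos (show 0 < L + 2 by positivity)]
    gcongr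
    rw [abs_le]
    rcases hst with hst | hst <;> rw [hst] <;> constructor <;> linarith
  have hsqrt : Real.sqrt (((l j : ℝ) + 1) * ((l k : ℝ) + 1)) ≤ L + 1 :=
    sqrt_mul_le (by positivity) (by linarith) (by linarith)
  have h2 : ((multiDegree l + 1 : ℕ) : ℝ) + 1 = L + 2 := by push_cast; ring
  rw [h2]
  refine key _ _ ?_ (Real.sqrt_nonneg _) hsqrt
  by_cases hjk : j = k
  · subst hjk
    right
    simp only [Finsupp.add_apply, Finsupp.single_eq_same]
    rw [Real.sqrt_mul_self (by positivity), Real.sqrt_mul_self (by positivity)]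
    push_cast
    ring
  · left
    simp [hjk, Ne.symm hjk, mul_comm]

namespace IsMonomialSubmodule

variable {M : Submodule ℂ (H2Vec d r)}

/-- On the orthogonal complement of `V_n`, the projections onto the complements of `V_m` and
`V_{m + e_k}`, where `m + e_k = n + e_j`, differ only if `V` jumps both from `n` in the direction
`j` and from `m` in the direction `k`. -/
lemma fiberProjection_eq_or (hM : IsMonomialSubmodule M) {N : ℕ}
    (hN : ∀ k n, N ≤ n k → fiber M (n + Finsupp.single k 1) = fiber M n) {j k : Fin d}
    {m n : Fin d →₀ ℕ} (hmn : m + Finsupp.single k 1 = n + Finsupp.single j 1)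
    {ζ : EuclideanSpace ℂ (Fin r)} (hζ : ζ ∈ (fiber M n)ᗮ) :
    fiberProjection M m ζ = fiberProjection M (m + Finsupp.single k 1) ζ ∨
      (m k < N ∧ n j < N) := by
  by_cases hm : N ≤ m k
  · left
    simp only [fiberProjection, hN k m hm]
  by_cases hn : N ≤ n j
  · left
    have h1 : fiber M (m + Finsupp.single k 1) = fiber M n := by rw [hmn, hN j n hn]
    have h2 : fiber M m ≤ fiber M n := h1 ▸ hM.fiber_mono le_self_add
    rw [fiberProjection_eq_self (Submodule.orthogonal_le h2 hζ),
      fiberProjection_eq_self (by rwa [h1])]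
  · exact .inr ⟨not_le.1 hm, not_le.1 hn⟩

/-- The commutator `[T_j, T_k*]` maps the `n`th coordinate space to the one of index
`n + e_j - e_k`. Away from the jumps of `V` its norm there is `O(1 / |n|)` by comparison of the
weights. At a jump the exponents of `z_j` and `z_k` are both bounded, which makes the weights
themselves `O(1 / |n|)`. -/
lemma inWeakSchatten_commutator (hM : IsMonomialSubmodule M) (j k : Fin d) :
    InWeakSchatten d (compressedShift M j * star (compressedShift M k) -
      star (compressedShift M k) * compressedShift M j) := by
  obtain ⟨N, hN⟩ := exists_bound_of_monotone (fiber M) hM.fiber_mono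
  have hcoord : ∀ m ξ, coordinateOn M m ((compressedShift M j * star (compressedShift M k) -
      star (compressedShift M k) * compressedShift M j) ξ) =
        coordinateOn M m (compressedShift M j (star (compressedShift M k) ξ)) -
          (shiftWeight k m : ℂ) •
            coordinateOn M (m + Finsupp.single k 1) (compressedShift M j ξ) := by
    intro m ξ
    rw [← hM.coordinateOn_star_compressedShift, ← map_sub]
    rfl
  refine inWeakSchatten_of_coordinate (coordinateOn M) hasSum_norm_coordinateOn_sq _
    (c := 3 * N + 1) (by positivity) j k (fun m ξ hm => ?_) fun m n ξ hmn => ?_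
  · have h0 : (m + Finsupp.single k 1 : Fin d →₀ ℕ) j = 0 := by
      rw [Finsupp.single_le_iff] at hm
      omega
    have h1 : m j = 0 := by
      rw [Finsupp.add_apply] at h0
      omega
    rw [hcoord, hM.coordinateOn_compressedShift_of_eq_zero h1,
      hM.coordinateOn_compressedShift_of_eq_zero h0, smul_zero, sub_zero]
  · have hdeg : multiDegree m = multiDegree n := by
      have := congrArg multiDegree hmn
      rwa [multiDegree_add_single, multiDegree_add_single, Nat.add_right_cancel_iff] at this
    set ζ := coordinateOn M n ξ with hζ
    have hζmem : ζ ∈ (fiber M n)ᗮ := coordinateOn_mem n ξ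
    have hsecond : (shiftWeight k m : ℂ) •
        coordinateOn M (m + Finsupp.single k 1) (compressedShift M j ξ) =
          ((shiftWeight k m * shiftWeight j n : ℝ) : ℂ) •
            fiberProjection M (m + Finsupp.single k 1) ζ := by
      rw [hmn, hM.coordinateOn_compressedShift, smul_smul, Complex.ofReal_mul]
    have hnorm : ∀ (c : ℝ) (l : Fin d →₀ ℕ), 0 ≤ c →
        ‖(c : ℂ) • fiberProjection M l ζ‖ ≤ c * ‖ζ‖ := by
      intro c l hc
      rw [norm_smul, Complex.norm_real, Real.norm_of_nonneg hc]
      exact mul_le_mul_of_nonneg_left (norm_fiberProjection_le l ζ) hc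
    rw [hcoord, hsecond]
    by_cases hmj : m j = 0
    · -- If `z_j` does not divide `z^m`, then `j = k` and only `T_k* T_k` contributes.
      have hjk : k = j := by
        by_contra hne
        have := DFunLike.congr_fun hmn j
        simp [hne, hmj] at this
      subst hjk
      have hmn' : m = n := add_right_cancel hmn
      subst hmn'
      rw [hM.coordinateOn_compressedShift_of_eq_zero hmj, zero_sub, norm_neg]
      refine (hnorm _ _ (mul_nonneg (shiftWeight_nonneg _ _) (shiftWeight_nonneg _ _))).trans ?_
      rw [shiftWeight_mul_self, hmj, Nat.cast_zero, zero_add]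
      gcongr
      linarith [Nat.cast_nonneg (α := ℝ) N]
    · obtain ⟨l, rfl⟩ : ∃ l, m = l + Finsupp.single j 1 :=
        ⟨m - Finsupp.single j 1, (tsub_add_cancel_of_le
          (Finsupp.single_le_iff.2 (Nat.one_le_iff_ne_zero.2 hmj))).symm⟩
      obtain rfl : l + Finsupp.single k 1 = n := by
        refine add_right_cancel (b := Finsupp.single j 1) ?_
        rw [← hmn, add_right_comm]
      have hfirst : coordinateOn M (l + Finsupp.single j 1)
          (compressedShift M j (star (compressedShift M k) ξ)) =
            ((shiftWeight j l * shiftWeight k l : ℝ) : ℂ) •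
              fiberProjection M (l + Finsupp.single j 1) ζ := by
        rw [hM.coordinateOn_compressedShift, hM.coordinateOn_star_compressedShift, map_smul,
          smul_smul, Complex.ofReal_mul]
      have hL : (multiDegree (l + Finsupp.single k 1) : ℝ) + 1 = (multiDegree l : ℝ) + 2 := by
        rw [multiDegree_add_single]
        push_cast
        ring
      rw [hfirst, hL]
      rcases hM.fiberProjection_eq_or hN hmn hζmem with heq | ⟨hmN, hnN⟩
      · rw [heq, ← sub_smul, ← Complex.ofReal_sub, norm_smul, Complex.norm_real, Real.norm_eq_abs]
        refine mul_le_mul ((abs_shiftWeight_mul_sub_le j k l).trans ?_)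
          (norm_fiberProjection_le _ ζ) (norm_nonneg _) (by positivity)
        gcongr
        linarith [Nat.cast_nonneg (α := ℝ) N]
      · have hlk : ((l k : ℝ) + 1) ≤ N := by
          have : l k + 1 ≤ N := by rw [Finsupp.add_apply] at hmN; omega
          exact_mod_cast this
        have hlj : ((l j : ℝ) + 1) ≤ N := by
          have : l j + 1 ≤ N := by rw [Finsupp.add_apply] at hnN; omega
          exact_mod_cast this
        have hmk : (((l + Finsupp.single j 1 : Fin d →₀ ℕ) k : ℝ) + 1) ≤ N := by exact_mod_cast hmN
        have hnj : (((l + Finsupp.single k 1 : Fin d →₀ ℕ) j : ℝ) + 1) ≤ N := by exact_mod_cast hnN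
        have ha : shiftWeight j l * shiftWeight k l ≤ 2 * N / ((multiDegree l : ℝ) + 2) := by
          rw [shiftWeight_mul_eq rfl]
          have hs : Real.sqrt (((l j : ℝ) + 1) * ((l k : ℝ) + 1)) ≤ N :=
            sqrt_mul_le (by positivity) hlj hlk
          rw [div_le_div_iff₀ (by positivity) (by positivity)]
          have hl0 : (0 : ℝ) ≤ multiDegree l := Nat.cast_nonneg _
          nlinarith [Nat.cast_nonneg (α := ℝ) N, mul_nonneg (Nat.cast_nonneg (α := ℝ) N) hl0]
        have hb : shiftWeight k (l + Finsupp.single j 1) * shiftWeight j (l + Finsupp.single k 1) ≤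
            N / ((multiDegree l : ℝ) + 2) := by
          rw [shiftWeight_mul_eq (by simp only [multiDegree_add_single]), hL]
          gcongr
          exact sqrt_mul_le (by positivity) hmk hnj
        refine (norm_sub_le _ _).trans ((add_le_add
          (hnorm _ _ (mul_nonneg (shiftWeight_nonneg _ _) (shiftWeight_nonneg _ _)))
          (hnorm _ _ (mul_nonneg (shiftWeight_nonneg _ _) (shiftWeight_nonneg _ _)))).trans ?_)
        rw [← add_mul]
        refine mul_le_mul_of_nonneg_right ((add_le_add ha hb).trans ?_) (norm_nonneg _)
        rw [← add_div]
        exact div_le_div_of_nonneg_right (by linarith) (by positivity)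

lemma coordinateOn_mul_star (hM : IsMonomialSubmodule M) (k : Fin d) (m : Fin d →₀ ℕ) (ξ : Mᗮ) :
    coordinateOn M m ((compressedShift M k * star (compressedShift M k)) ξ) =
      ((m k / multiDegree m : ℝ) : ℂ) • coordinateOn M m ξ := by
  change coordinateOn M m (compressedShift M k (star (compressedShift M k) ξ)) = _
  by_cases hmk : m k = 0
  · rw [hM.coordinateOn_compressedShift_of_eq_zero hmk, hmk]
    simp
  · obtain ⟨l, rfl⟩ : ∃ l, m = l + Finsupp.single k 1 :=
      ⟨m - Finsupp.single k 1, (tsub_add_cancel_of_le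
        (Finsupp.single_le_iff.2 (Nat.one_le_iff_ne_zero.2 hmk))).symm⟩
    rw [hM.coordinateOn_compressedShift, hM.coordinateOn_star_compressedShift, map_smul,
      fiberProjection_eq_self (coordinateOn_mem _ ξ), smul_smul, ← Complex.ofReal_mul,
      shiftWeight_mul_self, multiDegree_add_single]
    simp

/-- The defect `1 - ∑ T_k T_k*` is the projection onto the constants in `M^⊥`. -/
lemma hasFiniteRange_defect (hM : IsMonomialSubmodule M) :
    (∑ k, compressedShift M k * star (compressedShift M k) - 1).toLinearMap.HasFiniteRange := by
  refine (finrank_range_le_of_ker_le_ker (coordinateOn M 0).toLinearMap _ fun ξ hξ => ?_).1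
  have h0 : coordinateOn M 0 ξ = 0 := hξ
  refine eq_zero_of_coordinateOn fun m => ?_
  change coordinateOn M m ((∑ k, compressedShift M k * star (compressedShift M k) - 1) ξ) = 0
  rw [sub_apply, sum_apply, map_sub, map_sum]
  simp only [hM.coordinateOn_mul_star]
  rw [← Finset.sum_smul, ← Complex.ofReal_sum, ← Finset.sum_div, ← Nat.cast_sum]
  by_cases hm : multiDegree m = 0
  · have : m = 0 := by
      ext k
      exact Nat.eq_zero_of_le_zero (hm ▸ le_multiDegree m k)
    subst this
    simp [h0]
  · change (((multiDegree m : ℝ) / multiDegree m : ℝ) : ℂ) • _ - _ = _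
    rw [div_self (by exact_mod_cast hm), Complex.ofReal_one, one_smul]
    exact sub_self _

/-- Modulo norm limits of operators of finite rank, `D² = ∑ T_k T_k* ⊗ 1 = 1`. -/
lemma isFredholm_dirac (hM : IsMonomialSubmodule M) : (dirac (compressedShift M)).IsFredholm := by
  refine isFredholm_of_sq ?_
  have hlim : ∀ j k, IsFiniteRankLimit (star (compressedShift M j) * compressedShift M k -
      compressedShift M k * star (compressedShift M j)) := fun j k => by
    have h := (hM.inWeakSchatten_commutator k j).neg
    rw [neg_sub] at h
    exact h.isFiniteRankLimit
  have hsplit : TensorProduct.mapL (∑ k, compressedShift M k * star (compressedShift M k))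
      (1 : Exterior d →L[ℂ] Exterior d) =
        TensorProduct.mapL (∑ k, compressedShift M k * star (compressedShift M k) - 1) 1 + 1 := by
    have h1 : (1 : Mᗮ ⊗[ℂ] Exterior d →L[ℂ] Mᗮ ⊗[ℂ] Exterior d) = TensorProduct.mapL 1 1 :=
      TensorProduct.mapL_id_id.symm
    rw [h1, ← TensorProduct.mapL_add_left, sub_add_cancel]
  rw [dirac_mul_dirac _ hM.commute_compressedShift, hsplit, add_right_comm, add_sub_cancel_right]
  exact ((IsFiniteRankLimit.of_hasFiniteRange hM.hasFiniteRange_defect).mapL _).add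
    (.sum _ fun j => .sum _ fun k => (hlim j k).mapL _)

end IsMonomialSubmodule

end Commutators

end DShift

end

theorem mainTheorem2 (d r : ℕ) (hd : 0 < d) (hr : 0 < r)
    (X : Set (DShift.H2Vec d r)) (hX : X ⊆ DShift.monomials d r)
    (M : Submodule ℂ (DShift.H2Vec d r))
    (hM : M = DShift.closedInvariantSpan (DShift.vecShift d r) X)
    (T : Fin d → (Mᗮ →L[ℂ] Mᗮ))
    (hT : ∀ k, T k = DShift.compression Mᗮ (DShift.vecShift d r k)) :
    (∀ p : ℝ, (d : ℝ) < p →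
      ∀ x ∈ DShift.commutatorIdeal (StarAlgebra.adjoin ℂ (Set.range T)),
        DShift.InSchatten p (x : Mᗮ →L[ℂ] Mᗮ)) ∧
    DShift.IsFredholmMultioperator T := by
  have hmono : DShift.IsMonomialSubmodule M :=
    hM ▸ DShift.isMonomialSubmodule_closedInvariantSpan hX
  obtain rfl : T = DShift.compressedShift M := funext hT
  refine ⟨fun p hp x hx => ?_, hmono.commute_compressedShift, hmono.isFredholm_dirac⟩
  exact (DShift.inWeakSchatten_of_mem_commutatorIdeal _ hmono.commute_compressedShift
    hmono.inWeakSchatten_commutator x hx).inSchatten hd hp
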